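/- Let $G$ be a unimodular locally compact (Hausdorff) group with a fixed left Haar measure $\lambda$ (unimodular means that $\lambda$ is also right invariant), and let $1<p\le 2$. For measurable functions $g,f:G\to\mathbb C$ put $$ (g*f)(x)=\int_G g(y)\,f(y^{-1}x)\,d\lambda(y) $$ at each $x\in G$ for which $y\mapsto g(y)f(y^{-1}x)$ is $\lambda$-integrable, and say that $g*f$ exists if this is the case for $\lambda$-almost every $x\in G$. Let $L_p^T(G)$ be the space of all $f\in L^p(G)$ such that for every $g\in L^p(G)$ the convolution $g*f$ exists and belongs to $L^p(G)$, and such that $$ \|f\|_p^T=\sup\{\|g*f\|_p : g\in L^p(G),\ \|g\|_p\le 1\}<\infty . $$ Then the norms $\|\cdot\|_p$ and $\|\cdot\|_p^T$ are equivalent on $L_p^T(G)$, that is, there are constants $c,C>0$ with $c\|f\|_p\le\|f\|_p^T\le C\|f\|_p$ for all $f\in L_p^T(G)$, if and only if $G$ is finite. -/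

import Mathlib

open MeasureTheory
open scoped ENNReal NNReal

namespace LpT

section Convolution

variable {G : Type*} [Group G] [MeasurableSpace G]

/-- The convolution `(g * f)(x)` is defined at `x`: the function `y ↦ g y * f (y⁻¹ * x)` is
`μ`-integrable. -/
def ConvExistsAt (μ : Measure G) (g f : G → ℂ) (x : G) : Prop :=
  Integrable (fun y : G => g y * f (y⁻¹ * x)) μ

/-- The convolution `g * f` exists: it is defined at `μ`-almost every point. -/
def ConvExists (μ : Measure G) (g f : G → ℂ) : Prop :=
  ∀ᵐ x ∂μ, ConvExistsAt μ g f x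

/-- The convolution `(g * f)(x) = ∫ g(y) f(y⁻¹ x) dμ(y)`. -/
noncomputable def conv (μ : Measure G) (g f : G → ℂ) (x : G) : ℂ :=
  ∫ y, g y * f (y⁻¹ * x) ∂μ

/-- `‖f‖_p^T = sup {‖g * f‖_p : g ∈ L^p(G), ‖g‖_p ≤ 1}`, as an element of `[0, ∞]`. -/
noncomputable def normT (μ : Measure G) (p : ℝ≥0∞) (f : G → ℂ) : ℝ≥0∞ :=
  ⨆ g ∈ {g : G → ℂ | MemLp g p μ ∧ eLpNorm g p μ ≤ 1}, eLpNorm (conv μ g f) p μ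

/-- The space `L_p^T(G)`, given by representatives of its elements: the functions `f ∈ L^p(G)` such
that for every `g ∈ L^p(G)` the convolution `g * f` exists and belongs to `L^p(G)`, and such that
`‖f‖_p^T < ∞`. -/
def space (μ : Measure G) (p : ℝ≥0∞) : Set (G → ℂ) :=
  {f | MemLp f p μ ∧
    (∀ g : G → ℂ, MemLp g p μ → ConvExists μ g f ∧ MemLp (conv μ g f) p μ) ∧
    normT μ p f < ∞}

end Convolution

/-- Two norms, both finite on `S`, are equivalent on `S`: each one is bounded on `S` by a constant
multiple of the other. -/
def EquivalentOn {X : Type*} (S : Set X) (N₁ N₂ : X → ℝ≥0∞) : Prop :=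
  (∃ C : ℝ≥0, 0 < C ∧ ∀ f ∈ S, N₁ f ≤ C * N₂ f) ∧
    (∃ C : ℝ≥0, 0 < C ∧ ∀ f ∈ S, N₂ f ≤ C * N₁ f)

end LpT

/-! If `G` is finite, it is compact and discrete. Young's inequality `‖g * f‖_p ≤ ‖g‖_p ‖f‖_1` with
Hölder on a finite measure gives `‖f‖_p^T ≤ C ‖f‖_p`, and convolving with the indicator of the
identity gives the reverse bound.

Conversely, Young's inequality puts continuous compactly supported functions in the space with
`‖f‖_p^T ≤ ‖f‖_1`, so equivalence yields `‖f‖_p ≤ C ‖f‖_1` for them. Bumps concentrated near the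
identity violate this unless `G` is discrete (`discreteTopology_of_eLpNorm_le`). On a discrete group
the other half of the equivalence says that the `ℓ^p` norm is submultiplicative up to a constant,
and `not_bounded_mul` excludes this for infinite `G`.

For `not_bounded_mul` it suffices to use nonnegative finitely supported functions. Large finite
subgroups `H` contradict boundedness through `1_H * 1_H = |H| 1_H`; if they are not available, some
finitely generated subgroup is infinite. There let `u` be the indicator of a finite symmetric
generating set. Nonnegativity gives `‖f‖ ‖g‖ ≤ ‖f * g‖`, so `‖u ^ n‖` is multiplicative up to a
constant and comparable to `ρ ^ n`. Put `v = u / ρ`. The averages `A_N` of `1, v, …, v ^ (N - 1)`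
have norms bounded above and below and are asymptotically fixed by `v`.

A pointwise limit of the `A_N` is a nonnegative eigenfunction in `ℓ^p ⊆ ℓ^2`, and a Perron–Frobenius
argument makes it vanish (`eigen_eq_zero`). Hence one can pick `A_{N_1}, …, A_{N_j}` almost
disjoint, with sum `f` satisfying `‖f‖_p^p ≤ 2 j`. But `f * f` dominates the sum over `i` of
approximately `i A_{N_i}`, so `‖f * f‖_p^p` has order at least `j ^ (p + 1)`, whereas boundedness
allows only order `j ^ 2`; this is impossible as `p > 1`. -/

namespace LpT

/-! ### The `ℓ^p` norm on nonnegative finitely supported functions -/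

section MonoidAlgebra

open MonoidAlgebra

variable {G : Type*} {p : ℝ}

/-- The sum of the `p`-th powers of the coefficients of `f`. -/
noncomputable def powSum (p : ℝ) (f : MonoidAlgebra ℝ≥0 G) : ℝ≥0 :=
  f.coeff.sum fun _ a => a ^ p

/-- The `ℓ^p` norm of the coefficients of `f`. -/
noncomputable def lpNorm (p : ℝ) (f : MonoidAlgebra ℝ≥0 G) : ℝ≥0 :=
  powSum p f ^ (1 / p)

theorem powSum_eq_sum (hp : 0 < p) (f : MonoidAlgebra ℝ≥0 G) {s : Finset G}
    (hs : f.coeff.support ⊆ s) : powSum p f = ∑ x ∈ s, f.coeff x ^ p :=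
  Finsupp.sum_of_support_subset _ hs _ fun _ _ => NNReal.zero_rpow hp.ne'

theorem sum_le_powSum (hp : 0 < p) (f : MonoidAlgebra ℝ≥0 G) (s : Finset G) :
    ∑ x ∈ s, f.coeff x ^ p ≤ powSum p f := by
  classical
  rw [powSum_eq_sum hp f (s := f.coeff.support ∪ s) Finset.subset_union_left]
  exact Finset.sum_le_sum_of_subset Finset.subset_union_right

theorem lpNorm_rpow (hp : 0 < p) (f : MonoidAlgebra ℝ≥0 G) : lpNorm p f ^ p = powSum p f := by
  rw [lpNorm, ← NNReal.rpow_mul, one_div_mul_cancel hp.ne', NNReal.rpow_one]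

/-- Nonnegative coefficients cannot cancel, so this is `a ^ p + b ^ p ≤ (a + b) ^ p` applied
pointwise. Every lower bound on norms below rests on it. -/
theorem powSum_add_ge (hp : 1 ≤ p) (f g : MonoidAlgebra ℝ≥0 G) :
    powSum p f + powSum p g ≤ powSum p (f + g) := by
  classical
  have h0 : 0 < p := by linarith
  rw [powSum_eq_sum h0 f (s := f.coeff.support ∪ g.coeff.support) Finset.subset_union_left,
    powSum_eq_sum h0 g (s := f.coeff.support ∪ g.coeff.support) Finset.subset_union_right,
    powSum_eq_sum h0 (f + g) (s := f.coeff.support ∪ g.coeff.support)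
      (by rw [coeff_add]; exact Finsupp.support_add), ← Finset.sum_add_distrib]
  exact Finset.sum_le_sum fun x _ => NNReal.add_rpow_le_rpow_add _ _ hp

theorem powSum_le_of_add_eq (hp : 1 ≤ p) {f g h : MonoidAlgebra ℝ≥0 G} (e : f + h = g) :
    powSum p f ≤ powSum p g :=
  e ▸ le_self_add.trans (powSum_add_ge hp f h)

theorem lpNorm_le_add (hp : 1 ≤ p) (f g : MonoidAlgebra ℝ≥0 G) :
    lpNorm p f ≤ lpNorm p (f + g) :=
  NNReal.rpow_le_rpow (powSum_le_of_add_eq hp rfl) (by positivity)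

theorem lpNorm_add_le (hp : 1 ≤ p) (f g : MonoidAlgebra ℝ≥0 G) :
    lpNorm p (f + g) ≤ lpNorm p f + lpNorm p g := by
  classical
  have h0 : 0 < p := by linarith
  rw [lpNorm, lpNorm, lpNorm,
    powSum_eq_sum h0 f (s := f.coeff.support ∪ g.coeff.support) Finset.subset_union_left,
    powSum_eq_sum h0 g (s := f.coeff.support ∪ g.coeff.support) Finset.subset_union_right,
    powSum_eq_sum h0 (f + g) (s := f.coeff.support ∪ g.coeff.support)
      (by rw [coeff_add]; exact Finsupp.support_add)]
  exact NNReal.Lp_add_le _ _ _ hp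

theorem powSum_zero : powSum p (0 : MonoidAlgebra ℝ≥0 G) = 0 := by simp [powSum]

theorem lpNorm_zero (hp : 0 < p) : lpNorm p (0 : MonoidAlgebra ℝ≥0 G) = 0 := by
  rw [lpNorm, powSum_zero, NNReal.zero_rpow (by positivity)]

theorem lpNorm_sum_le (hp : 1 ≤ p) {ι : Type*} (s : Finset ι) (f : ι → MonoidAlgebra ℝ≥0 G) :
    lpNorm p (∑ i ∈ s, f i) ≤ ∑ i ∈ s, lpNorm p (f i) :=
  Finset.le_sum_of_subadditive _ (lpNorm_zero (by linarith)).le (lpNorm_add_le hp) _ _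

theorem sum_powSum_le (hp : 1 ≤ p) {ι : Type*} (s : Finset ι) (f : ι → MonoidAlgebra ℝ≥0 G) :
    ∑ i ∈ s, powSum p (f i) ≤ powSum p (∑ i ∈ s, f i) := by
  classical
  induction s using Finset.induction_on with
  | empty => simp
  | insert a s ha ih =>
    rw [Finset.sum_insert ha, Finset.sum_insert ha]
    exact (add_le_add_right ih _).trans (powSum_add_ge hp _ _)

theorem powSum_single (hp : 0 < p) (x : G) (a : ℝ≥0) : powSum p (single x a) = a ^ p := by
  rw [powSum, coeff_single]
  exact Finsupp.sum_single_index (NNReal.zero_rpow hp.ne')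

theorem powSum_smul (hp : 0 < p) (c : ℝ≥0) (f : MonoidAlgebra ℝ≥0 G) :
    powSum p (c • f) = c ^ p * powSum p f := by
  rw [powSum_eq_sum hp (c • f) (s := f.coeff.support)
    (by rw [coeff_smul]; exact Finsupp.support_smul), powSum_eq_sum hp f subset_rfl,
    Finset.mul_sum]
  exact Finset.sum_congr rfl fun x _ => by
    rw [coeff_smul_apply, smul_eq_mul, NNReal.mul_rpow]

theorem lpNorm_smul (hp : 0 < p) (c : ℝ≥0) (f : MonoidAlgebra ℝ≥0 G) :
    lpNorm p (c • f) = c * lpNorm p f := by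
  rw [lpNorm, powSum_smul hp, NNReal.mul_rpow, ← NNReal.rpow_mul, mul_one_div_cancel hp.ne',
    NNReal.rpow_one, lpNorm]

theorem powSum_mapDomain {H : Type*} {φ : H → G} (hφ : Function.Injective φ)
    (f : MonoidAlgebra ℝ≥0 H) : powSum p (mapDomain φ f) = powSum p f := by
  rw [powSum, coeff_mapDomain, Finsupp.sum_mapDomain_index_inj hφ, powSum]

variable [Group G]

theorem powSum_single_mul (hp : 0 < p) (x : G) (a : ℝ≥0) (f : MonoidAlgebra ℝ≥0 G) :
    powSum p (single x a * f) = a ^ p * powSum p f := by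
  have h : single x a * f = a • mapDomain (fun y => x * y) f := by
    ext y
    rw [coeff_smul_apply, coeff_single_mul_apply, coeff_mapDomain]
    nth_rw 2 [show y = x * (x⁻¹ * y) by group]
    rw [Finsupp.mapDomain_apply (mul_right_injective x), smul_eq_mul]
  rw [h, powSum_smul hp, powSum_mapDomain (mul_right_injective x)]

/-- The product is a sum of scaled translates of `g`, one for each point of the support of `f`;
superadditivity of `powSum` applies. -/
theorem powSum_mul_ge (hp : 1 ≤ p) (f g : MonoidAlgebra ℝ≥0 G) :
    powSum p f * powSum p g ≤ powSum p (f * g) := by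
  have h0 : 0 < p := by linarith
  have h : f = ∑ x ∈ f.coeff.support, single x (f.coeff x) := by
    refine coeff_injective ?_
    simp only [coeff_sum, coeff_single]
    exact f.coeff.sum_single.symm
  conv_rhs => rw [h, Finset.sum_mul]
  refine le_trans ?_ (sum_powSum_le hp _ _)
  rw [powSum_eq_sum h0 f subset_rfl, Finset.sum_mul]
  exact Finset.sum_le_sum fun x _ => (powSum_single_mul h0 _ _ _).ge

theorem lpNorm_mul_ge (hp : 1 ≤ p) (f g : MonoidAlgebra ℝ≥0 G) :
    lpNorm p f * lpNorm p g ≤ lpNorm p (f * g) := by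
  rw [lpNorm, lpNorm, ← NNReal.mul_rpow]
  exact NNReal.rpow_le_rpow (powSum_mul_ge hp f g) (by positivity)

theorem lpNorm_one (hp : 0 < p) : lpNorm p (1 : MonoidAlgebra ℝ≥0 G) = 1 := by
  rw [lpNorm, one_def, powSum_single hp, NNReal.one_rpow, NNReal.one_rpow]

end MonoidAlgebra

/-! ### Almost multiplicative sequences -/

section Growth

theorem pow_le_apply_mul {a : ℕ → ℝ} (h0 : a 0 = 1) (hpos : ∀ n, 0 < a n)
    (hsuper : ∀ m n, a m * a n ≤ a (m + n)) (m n : ℕ) : a m ^ n ≤ a (m * n) := by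
  induction n with
  | zero => simp [h0]
  | succ n ih =>
    rw [pow_succ, mul_add_one]
    exact (mul_le_mul_of_nonneg_right ih (hpos m).le).trans (hsuper _ _)

theorem apply_mul_le_pow {a : ℕ → ℝ} {C : ℝ} (h0 : a 0 = 1) (hpos : ∀ n, 0 < a n)
    (hC : 0 ≤ C) (hsub : ∀ m n, a (m + n) ≤ C * a m * a n) (m n : ℕ) :
    a (n * m) ≤ (C * a n) ^ m := by
  induction m with
  | zero => simp [h0]
  | succ m ih =>
    rw [pow_succ, mul_add_one, mul_comm]
    refine (hsub _ _).trans ?_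
    have := mul_le_mul_of_nonneg_right ih (mul_nonneg hC (hpos n).le)
    rw [mul_comm m n]
    linarith

/-- A positive sequence which is multiplicative up to a constant grows like a geometric one. -/
theorem exists_growth_rate {a : ℕ → ℝ} {C : ℝ} (h0 : a 0 = 1) (hpos : ∀ n, 0 < a n)
    (hC : 1 ≤ C) (hsuper : ∀ m n, a m * a n ≤ a (m + n))
    (hsub : ∀ m n, a (m + n) ≤ C * a m * a n) :
    ∃ ρ : ℝ, 0 < ρ ∧ ∀ n, a n ≤ ρ ^ n ∧ ρ ^ n ≤ C * a n := by
  -- A Fekete argument: `a m ^ n ≤ a (m * n) ≤ (C * a n) ^ m` for positive `m`, `n`. The rate is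
  -- then the supremum of the roots `a m ^ (1 / m)`.
  have key : ∀ m n : ℕ, a (m + 1) ^ (((m + 1 : ℕ) : ℝ)⁻¹) ≤
      (C * a (n + 1)) ^ (((n + 1 : ℕ) : ℝ)⁻¹) := by
    intro m n
    have h := (pow_le_apply_mul h0 hpos hsuper (m + 1) (n + 1)).trans
      (mul_comm (m + 1) (n + 1) ▸ apply_mul_le_pow h0 hpos (by linarith) hsub (m + 1) (n + 1))
    have hCa : 0 ≤ C * a (n + 1) := mul_nonneg (by linarith) (hpos _).le
    rw [← pow_le_pow_iff_left₀ (Real.rpow_nonneg (hpos _).le _) (Real.rpow_nonneg hCa _)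
      (Nat.mul_ne_zero m.succ_ne_zero n.succ_ne_zero), pow_mul,
      Real.rpow_inv_natCast_pow (hpos _).le m.succ_ne_zero, mul_comm m.succ, pow_mul,
      Real.rpow_inv_natCast_pow hCa n.succ_ne_zero]
    exact h
  have hbdd : BddAbove (Set.range fun m : ℕ => a (m + 1) ^ (((m + 1 : ℕ) : ℝ)⁻¹)) :=
    ⟨_, by rintro _ ⟨m, rfl⟩; exact key m 0⟩
  have hle := fun m => le_ciSup hbdd m
  have hpos' : 0 < ⨆ m : ℕ, a (m + 1) ^ (((m + 1 : ℕ) : ℝ)⁻¹) :=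
    (Real.rpow_pos_of_pos (hpos 1) _).trans_le (hle 0)
  refine ⟨_, hpos', fun n => ?_⟩
  rcases n with _ | n
  · simp [h0, hC]
  constructor
  · rw [← Real.rpow_inv_natCast_pow (hpos (n + 1)).le n.succ_ne_zero]
    exact pow_le_pow_left₀ (Real.rpow_nonneg (hpos _).le _) (hle n) _
  · have hCa : 0 ≤ C * a (n + 1) := mul_nonneg (by linarith) (hpos _).le
    rw [← Real.rpow_inv_natCast_pow hCa n.succ_ne_zero]
    exact pow_le_pow_left₀ hpos'.le (ciSup_le fun m => key m n) _

end Growth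

/-! ### Perron–Frobenius for square summable eigenfunctions -/

section Perron

variable {G : Type*} [Group G]

/-- A nonnegative eigenfunction of a symmetric generating set is positive unless it vanishes. -/
theorem pos_of_eigen {φ : G → ℝ} {ρ : ℝ} {S : Finset G} (hρ : 0 < ρ) (hφ : ∀ z, 0 ≤ φ z)
    (hinv : ∀ s ∈ S, s⁻¹ ∈ S) (hgen : Subgroup.closure (S : Set G) = ⊤)
    (heig : ∀ z, ∑ s ∈ S, φ (s⁻¹ * z) = ρ * φ z) {x : G} (hx : 0 < φ x) (y : G) : 0 < φ y := by
  have hS : ∀ s ∈ S, ∀ z, 0 < φ z → 0 < φ (s * z) := by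
    intro s hs z hz
    have h1 : φ (s⁻¹ * (s * z)) ≤ ∑ t ∈ S, φ (t⁻¹ * (s * z)) :=
      Finset.single_le_sum (f := fun t => φ (t⁻¹ * (s * z))) (fun _ _ => hφ _) hs
    rw [heig, inv_mul_cancel_left] at h1
    exact pos_of_mul_pos_right (hz.trans_le h1) hρ.le
  have hall : ∀ g ∈ Subgroup.closure (S : Set G), ∀ z, 0 < φ z → 0 < φ (g * z) := by
    intro g hg
    induction hg using Subgroup.closure_induction'' with
    | mem s hs => exact hS s hs
    | inv_mem s hs => exact hS _ (hinv s hs)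
    | one => simp
    | mul a b _ _ ha hb => intro z hz; rw [mul_assoc]; exact ha _ (hb _ hz)
  simpa using hall (y * x⁻¹) (hgen ▸ Subgroup.mem_top _) x hx

/-- A nonnegative subinvariant function which pairs with a positive eigenfunction is itself an
eigenfunction. -/
theorem eigen_of_subinvariant {φ ψ : G → ℝ} {ρ : ℝ} {S : Finset G}
    (hpos : ∀ z, 0 < φ z) (hinv : ∀ s ∈ S, s⁻¹ ∈ S)
    (heig : ∀ z, ∑ s ∈ S, φ (s⁻¹ * z) = ρ * φ z)
    (hφψ : ∀ s : G, Summable fun z => φ (s * z) * ψ z)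
    (hsub : ∀ z, ρ * ψ z ≤ ∑ s ∈ S, ψ (s⁻¹ * z)) (z : G) :
    ∑ s ∈ S, ψ (s⁻¹ * z) = ρ * ψ z := by
  have hφψ1 : Summable fun z => φ z * ψ z := by simpa using hφψ 1
  have hshift : ∀ s : G, Summable fun z => φ z * ψ (s⁻¹ * z) := fun s => by
    rw [← (Equiv.mulLeft s).summable_iff]
    simpa [Function.comp_def] using hφψ s
  have hshift' : ∀ s : G, ∑' z, φ z * ψ (s⁻¹ * z) = ∑' z, φ (s * z) * ψ z := fun s => by
    rw [← (Equiv.mulLeft s).tsum_eq]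
    simp
  have hsymm : ∀ z, ∑ s ∈ S, φ (s * z) = ∑ s ∈ S, φ (s⁻¹ * z) := fun z =>
    Finset.sum_nbij' (fun s => s⁻¹) (fun s => s⁻¹) hinv hinv (by simp) (by simp) (by simp)
  -- The operator is symmetric because `S` is, so it can be moved from `ψ` to the eigenfunction `φ`.
  -- As `φ` is positive, strict subinvariance at a single point would break this equality.
  have hsumeq : ∑' z, φ z * ∑ s ∈ S, ψ (s⁻¹ * z) = ∑' z, φ z * (ρ * ψ z) := by
    simp_rw [Finset.mul_sum]
    rw [Summable.tsum_finsetSum fun s _ => hshift s, Finset.sum_congr rfl fun s _ => hshift' s,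
      ← Summable.tsum_finsetSum fun s _ => hφψ s]
    refine tsum_congr fun z => ?_
    rw [← Finset.sum_mul, hsymm, heig]
    ring
  by_contra hne
  have hlt : φ z * (ρ * ψ z) < φ z * ∑ s ∈ S, ψ (s⁻¹ * z) :=
    mul_lt_mul_of_pos_left ((hsub z).lt_of_ne' hne) (hpos z)
  refine (Summable.tsum_lt_tsum (fun y => mul_le_mul_of_nonneg_left (hsub y) (hpos y).le) hlt
    ?_ ?_).ne' hsumeq
  · simpa only [mul_left_comm] using hφψ1.mul_left ρ
  · simp_rw [Finset.mul_sum]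
    exact summable_sum fun s _ => hshift s

/-- Right translation commutes with the operator, so the positive part `ψ` of `φ (z * t) - φ z` is
subinvariant, hence an eigenfunction. If it is nonzero it is positive everywhere; then `φ` increases
strictly under translation by `t`, although translation preserves the `ℓ^2` sum. -/
theorem eigen_mul_right_le {φ : G → ℝ} {ρ : ℝ} {S : Finset G} (hρ : 0 < ρ)
    (hpos : ∀ z, 0 < φ z) (hsum : Summable fun z => φ z ^ 2)
    (hinv : ∀ s ∈ S, s⁻¹ ∈ S) (hgen : Subgroup.closure (S : Set G) = ⊤)
    (heig : ∀ z, ∑ s ∈ S, φ (s⁻¹ * z) = ρ * φ z) (t z : G) : φ (z * t) ≤ φ z := by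
  have hsumr : Summable fun z => φ (z * t) ^ 2 :=
    (Equiv.mulRight t).summable_iff (f := fun z => φ z ^ 2).mpr hsum
  have hsuml : ∀ t : G, Summable fun z => φ (t * z) ^ 2 := fun t =>
    (Equiv.mulLeft t).summable_iff (f := fun z => φ z ^ 2).mpr hsum
  obtain ⟨ψ, hψ⟩ : ∃ ψ : G → ℝ, ∀ z, ψ z = max (φ (z * t) - φ z) 0 := ⟨_, fun _ => rfl⟩
  have hψ0 : ∀ z, 0 ≤ ψ z := fun z => hψ z ▸ le_max_right _ _
  have hψle : ∀ z, ψ z ≤ φ (z * t) := fun z =>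
    hψ z ▸ max_le (by linarith [hpos z]) (hpos _).le
  have hsub : ∀ z, ρ * ψ z ≤ ∑ s ∈ S, ψ (s⁻¹ * z) := by
    intro z
    rw [hψ, mul_max_of_nonneg _ _ hρ.le, mul_zero]
    refine max_le ?_ (Finset.sum_nonneg fun s _ => hψ0 _)
    rw [mul_sub, ← heig, ← heig, ← Finset.sum_sub_distrib]
    refine Finset.sum_le_sum fun s _ => ?_
    rw [hψ, ← mul_assoc]
    exact le_max_left _ _
  have hφψ : ∀ s : G, Summable fun z => φ (s * z) * ψ z := by
    intro s
    refine Summable.of_nonneg_of_le (fun z => mul_nonneg (hpos _).le (hψ0 _)) (fun z => ?_)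
      ((hsuml s).add hsumr)
    have h1 := mul_le_mul_of_nonneg_left (hψle z) (hpos (s * z)).le
    have h2 := two_mul_le_add_sq (φ (s * z)) (φ (z * t))
    linarith [mul_pos (hpos (s * z)) (hpos (z * t))]
  have heigψ := eigen_of_subinvariant hpos hinv heig hφψ hsub
  by_contra! hz
  have hψpos : ∀ y, 0 < ψ y :=
    pos_of_eigen hρ hψ0 hinv hgen heigψ (x := z) (hψ z ▸ lt_max_of_lt_left (by linarith))
  have hlt : ∀ y, φ y < φ (y * t) := fun y => by
    rcases lt_max_iff.mp (hψ y ▸ hψpos y) with h | h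
    · linarith
    · exact absurd h (lt_irrefl _)
  refine (Summable.tsum_lt_tsum (fun y => pow_le_pow_left₀ (hpos y).le (hlt y).le 2)
    (pow_lt_pow_left₀ (hlt 1) (hpos 1).le two_ne_zero) hsum hsumr).ne' ?_
  exact (Equiv.mulRight t).tsum_eq fun z => φ z ^ 2

/-- On an infinite group, a nonnegative square summable eigenfunction of a symmetric generating set
vanishes. -/
theorem eigen_eq_zero [Infinite G] {φ : G → ℝ} {ρ : ℝ} {S : Finset G} (hρ : 0 < ρ)
    (hφ : ∀ z, 0 ≤ φ z) (hsum : Summable fun z => φ z ^ 2)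
    (hinv : ∀ s ∈ S, s⁻¹ ∈ S) (hgen : Subgroup.closure (S : Set G) = ⊤)
    (heig : ∀ z, ∑ s ∈ S, φ (s⁻¹ * z) = ρ * φ z) (x : G) : φ x = 0 := by
  by_contra hx
  have hpos := pos_of_eigen hρ hφ hinv hgen heig ((hφ x).lt_of_ne' hx)
  have hle := eigen_mul_right_le hρ hpos hsum hinv hgen heig
  have hconst : ∀ z, φ z = φ 1 := fun z =>
    le_antisymm (by simpa using hle z 1) (by simpa using hle z⁻¹ z)
  have h2 : Summable fun _ : G => φ 1 ^ 2 := by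
    simp_rw [hconst] at hsum; exact hsum
  rw [summable_const_iff] at h2
  exact (pow_pos (hpos 1) 2).ne' h2

end Perron

/-! ### Averages of powers and their sparse sums -/

section Averages

open MonoidAlgebra Filter Topology

variable {G : Type*} {p : ℝ}

theorem coeff_le_lpNorm (hp : 0 < p) (f : MonoidAlgebra ℝ≥0 G) (x : G) :
    f.coeff x ≤ lpNorm p f := by
  rw [← NNReal.rpow_le_rpow_iff hp, lpNorm_rpow hp]
  simpa using sum_le_powSum hp f {x}

/-- Adding a function of norm at most one which is small on the support of `f` increases the sum of
`p`-th powers by little more than one. -/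
theorem exists_powSum_add_le (hp : 0 < p) (f : MonoidAlgebra ℝ≥0 G) :
    ∃ ε : ℝ≥0, 0 < ε ∧ ∀ w : MonoidAlgebra ℝ≥0 G, powSum p w ≤ 1 →
      (∀ x ∈ f.coeff.support, w.coeff x ≤ ε) → powSum p (f + w) ≤ powSum p f + 2 := by
  classical
  have hcont : Continuous fun ε : ℝ≥0 => ∑ x ∈ f.coeff.support, (f.coeff x + ε) ^ p :=
    continuous_finsetSum _ fun x _ =>
      (NNReal.continuous_rpow_const hp.le).comp (continuous_const.add continuous_id)
  have hev : ∀ᶠ ε in 𝓝 (0 : ℝ≥0),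
      ∑ x ∈ f.coeff.support, (f.coeff x + ε) ^ p < powSum p f + 1 := by
    refine (hcont.tendsto 0).eventually_lt_const ?_
    simp_rw [add_zero]
    rw [← powSum_eq_sum hp f subset_rfl]
    exact lt_add_one _
  obtain ⟨ε, hε, hε0⟩ := ((hev.filter_mono nhdsWithin_le_nhds).and
    (self_mem_nhdsWithin : Set.Ioi (0 : ℝ≥0) ∈ 𝓝[>] 0)).exists
  refine ⟨ε, hε0, fun w hw hsmall => ?_⟩
  -- The `2` is `1` for the change on the support of `f`, by continuity in `ε`, plus `1` for the
  -- part of `w` off that support.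
  rw [powSum_eq_sum hp (f + w) (s := f.coeff.support ∪ w.coeff.support)
      (by rw [coeff_add]; exact Finsupp.support_add),
    ← Finset.union_sdiff_self_eq_union, Finset.sum_union Finset.disjoint_sdiff,
    show (2 : ℝ≥0) = 1 + 1 by norm_num, ← add_assoc]
  refine add_le_add (le_trans (Finset.sum_le_sum fun x hx => ?_) hε.le) (le_trans ?_ hw)
  · rw [coeff_add, Finsupp.add_apply]
    exact NNReal.rpow_le_rpow (add_le_add_right (hsmall x hx) _) hp.le
  · refine le_trans (Finset.sum_le_sum fun x hx => ?_)
      (sum_le_powSum hp w (w.coeff.support \ f.coeff.support))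
    rw [coeff_add, Finsupp.add_apply, Finsupp.notMem_support_iff.mp (Finset.mem_sdiff.mp hx).2,
      zero_add]

variable [Group G]

/-- The sum `1 + v + ⋯ + v ^ (N - 1)`. -/
noncomputable def geom (v : MonoidAlgebra ℝ≥0 G) (N : ℕ) : MonoidAlgebra ℝ≥0 G :=
  ∑ n ∈ Finset.range N, v ^ n

/-- The average of `1, v, …, v ^ (N - 1)`. -/
noncomputable def avg (v : MonoidAlgebra ℝ≥0 G) (N : ℕ) : MonoidAlgebra ℝ≥0 G :=
  (N : ℝ≥0)⁻¹ • geom v N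

/-- Both sides are the sum of the first `i + N` powers. Over `ℝ≥0` differences are unavailable, so
error terms are added on opposite sides of an equation throughout. -/
theorem pow_mul_geom_add (v : MonoidAlgebra ℝ≥0 G) (i N : ℕ) :
    v ^ i * geom v N + geom v i = geom v N + v ^ N * geom v i := by
  have h : ∀ a b : ℕ, v ^ a * geom v b + geom v a = geom v (a + b) := fun a b => by
    rw [geom, geom, geom, Finset.sum_range_add, Finset.mul_sum, add_comm]
    simp_rw [pow_add]
  rw [h, add_comm i, ← h, add_comm]

theorem geom_mul_geom_add (v : MonoidAlgebra ℝ≥0 G) (M N : ℕ) :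
    geom v M * geom v N + ∑ i ∈ Finset.range M, geom v i =
      (M : ℝ≥0) • geom v N + v ^ N * ∑ i ∈ Finset.range M, geom v i := by
  conv_lhs => rw [geom, Finset.sum_mul, ← Finset.sum_add_distrib]
  simp_rw [pow_mul_geom_add]
  rw [Finset.sum_add_distrib, Finset.sum_const, Finset.card_range, Finset.mul_sum,
    Nat.cast_smul_eq_nsmul]

variable {v : MonoidAlgebra ℝ≥0 G}

theorem lpNorm_geom_le (hp : 1 ≤ p) (hv : ∀ n, lpNorm p (v ^ n) ≤ 1) (N : ℕ) :
    lpNorm p (geom v N) ≤ N := by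
  refine (lpNorm_sum_le hp _ _).trans ((Finset.sum_le_sum fun n _ => hv n).trans ?_)
  simp

theorem lpNorm_sum_geom_le (hp : 1 ≤ p) (hv : ∀ n, lpNorm p (v ^ n) ≤ 1) (M : ℕ) :
    lpNorm p (∑ i ∈ Finset.range M, geom v i) ≤ M * M := by
  refine (lpNorm_sum_le hp _ _).trans ((Finset.sum_le_sum fun n hn =>
    (lpNorm_geom_le hp hv n).trans (Nat.cast_le.mpr (Finset.mem_range.mp hn).le)).trans ?_)
  simp

/-- By superadditivity of `powSum`, each `v ^ n` contributes at least `C⁻¹ ^ p`. -/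
theorem tendsto_lpNorm_geom (hp : 1 ≤ p) {C : ℝ≥0} (hv' : ∀ n, 1 ≤ C * lpNorm p (v ^ n)) :
    Tendsto (fun N => lpNorm p (geom v N)) atTop atTop := by
  have h0 : 0 < p := by linarith
  have hC : C ≠ 0 := by rintro rfl; simpa using hv' 0
  have hpow : ∀ N : ℕ, N * C⁻¹ ^ p ≤ powSum p (geom v N) := fun N => by
    refine le_trans ?_ (sum_powSum_le hp _ _)
    rw [← nsmul_eq_mul, ← Finset.card_range N, ← Finset.sum_const, Finset.card_range]
    refine Finset.sum_le_sum fun n _ => ?_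
    rw [← lpNorm_rpow h0]
    refine NNReal.rpow_le_rpow ?_ h0.le
    rw [NNReal.inv_le hC]
    exact hv' n
  have h1 : Tendsto (fun N => powSum p (geom v N)) atTop atTop := by
    refine tendsto_atTop_mono hpow ?_
    exact tendsto_natCast_atTop_atTop.atTop_mul_const (NNReal.rpow_pos (by positivity))
  have h2 := (NNReal.tendsto_rpow_atTop (show 0 < 1 / p by positivity)).comp h1
  exact h2

variable {C : ℝ≥0}

/-- Otherwise `geom v M` would act with norm less than `M`. Yet `geom v M * geom v N` is `M • geom v
N` up to errors bounded independently of `N`, so `geom v N` would stay bounded as `N` grows. -/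
theorem le_lpNorm_geom (hp : 1 ≤ p)
    (hC : ∀ f g : MonoidAlgebra ℝ≥0 G, lpNorm p (f * g) ≤ C * lpNorm p f * lpNorm p g)
    (hv : ∀ n, lpNorm p (v ^ n) ≤ 1) (hv' : ∀ n, 1 ≤ C * lpNorm p (v ^ n)) (M : ℕ) :
    M ≤ C * lpNorm p (geom v M) := by
  have h0 : 0 < p := by linarith
  by_contra! hlt
  obtain ⟨δ, hδ⟩ := exists_add_of_le hlt.le
  have hδ0 : 0 < δ := by
    rcases eq_zero_or_pos δ with h | h
    · rw [h, add_zero] at hδ; exact absurd hδ hlt.ne'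
    · exact h
  have hb : ∀ N, δ * lpNorm p (geom v N) ≤ M * M := fun N => by
    have h1 : M * lpNorm p (geom v N) ≤
        C * lpNorm p (geom v M) * lpNorm p (geom v N) + M * M := by
      rw [← lpNorm_smul h0]
      refine (lpNorm_le_add hp _ (v ^ N * ∑ i ∈ Finset.range M, geom v i)).trans ?_
      rw [← geom_mul_geom_add]
      exact (lpNorm_add_le hp _ _).trans (add_le_add (hC _ _) (lpNorm_sum_geom_le hp hv M))
    rw [hδ, add_mul] at h1
    rw [hδ]
    exact le_of_add_le_add_left h1
  obtain ⟨N, hN⟩ := ((tendsto_lpNorm_geom hp hv').eventually_gt_atTop (M * M / δ)).exists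
  rw [div_lt_iff₀ hδ0, mul_comm (lpNorm p _)] at hN
  exact (hb N).not_gt hN

theorem lpNorm_avg_le (hp : 1 ≤ p) (hv : ∀ n, lpNorm p (v ^ n) ≤ 1) (N : ℕ) :
    lpNorm p (avg v N) ≤ 1 := by
  rw [avg, lpNorm_smul (by linarith)]
  exact (mul_le_mul_right (lpNorm_geom_le hp hv N) _).trans (inv_mul_le_one)

theorem one_le_lpNorm_avg (hp : 1 ≤ p)
    (hC : ∀ f g : MonoidAlgebra ℝ≥0 G, lpNorm p (f * g) ≤ C * lpNorm p f * lpNorm p g)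
    (hv : ∀ n, lpNorm p (v ^ n) ≤ 1) (hv' : ∀ n, 1 ≤ C * lpNorm p (v ^ n)) {N : ℕ}
    (hN : N ≠ 0) : 1 ≤ C * lpNorm p (avg v N) := by
  rw [avg, lpNorm_smul (by linarith), mul_left_comm]
  have hN' : (N : ℝ≥0) ≠ 0 := Nat.cast_ne_zero.mpr hN
  rw [← inv_mul_cancel₀ hN']
  exact mul_le_mul_right (le_lpNorm_geom hp hC hv hv' N) _

/-- Multiplying `avg v N` by `v ^ i` with `i < M` alters only the two ends of the sum, so a fixed
average almost fixes `avg v N` for large `N`. -/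
theorem exists_avg_mul_avg (hp : 1 ≤ p) (hv : ∀ n, lpNorm p (v ^ n) ≤ 1) {M : ℕ} (hM : M ≠ 0)
    (N : ℕ) : ∃ E R : MonoidAlgebra ℝ≥0 G, avg v M * avg v N + E = avg v N + R ∧
      lpNorm p E ≤ M * (N : ℝ≥0)⁻¹ := by
  have hM' : (M : ℝ≥0) ≠ 0 := Nat.cast_ne_zero.mpr hM
  refine ⟨((M : ℝ≥0)⁻¹ * (N : ℝ≥0)⁻¹) • ∑ i ∈ Finset.range M, geom v i,
    ((M : ℝ≥0)⁻¹ * (N : ℝ≥0)⁻¹) • (v ^ N * ∑ i ∈ Finset.range M, geom v i), ?_, ?_⟩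
  · rw [avg, avg, smul_mul_smul_comm, ← smul_add, geom_mul_geom_add, smul_add, smul_smul]
    congr 2
    field_simp
  · rw [lpNorm_smul (by linarith)]
    refine (mul_le_mul_right (lpNorm_sum_geom_le hp hv M) _).trans_eq ?_
    field_simp

/-- If averages of powers of `v` vanish at infinity along a subsequence, then there are sparse sums
of such averages with large squares. -/
theorem exists_sparse_sum (hp : 1 ≤ p)
    (hC : ∀ f g : MonoidAlgebra ℝ≥0 G, lpNorm p (f * g) ≤ C * lpNorm p f * lpNorm p g)
    (hv : ∀ n, lpNorm p (v ^ n) ≤ 1) (hv' : ∀ n, 1 ≤ C * lpNorm p (v ^ n))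
    (hweak : ∀ (K : Finset G) (ε : ℝ≥0), 0 < ε → ∀ n₀ : ℕ, ∃ N, n₀ ≤ N ∧
      ∀ x ∈ K, (avg v N).coeff x ≤ ε) (j : ℕ) :
    ∃ f : MonoidAlgebra ℝ≥0 G, powSum p f ≤ 2 * j ∧
      (∃ D : ℝ≥0, ∀ N : ℕ, ∃ E R : MonoidAlgebra ℝ≥0 G,
        f * avg v N + E = (j : ℝ≥0) • avg v N + R ∧ lpNorm p E ≤ D * (N : ℝ≥0)⁻¹) ∧
      ∑ i ∈ Finset.range j, ((i : ℝ≥0) / C - 1 / C) ^ p ≤ powSum p (f * f) := by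
  have h0 : 0 < p := by linarith
  have hC0 : C ≠ 0 := by rintro rfl; simpa using hv' 0
  induction j with
  | zero =>
    refine ⟨0, by simp [powSum_zero], ⟨0, fun N => ⟨0, 0, by simp, ?_⟩⟩, by simp⟩
    rw [lpNorm_zero h0]; exact zero_le
  | succ j ih =>
    obtain ⟨f, hf, ⟨D, hD⟩, hff⟩ := ih
    obtain ⟨ε, hε, hεf⟩ := exists_powSum_add_le h0 f
    -- Beyond `n₀` the error `D / N` in `f * avg v N ≈ j • avg v N` is at most `1 / C`. Smallness on
    -- the support of `f` costs at most `2` in `powSum`.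
    obtain ⟨n₀, hn₀⟩ := exists_nat_ge (C * D)
    obtain ⟨N, hN, hNε⟩ := hweak f.coeff.support ε hε (n₀ + 1)
    have hN0 : N ≠ 0 := by omega
    have hN0' : (N : ℝ≥0) ≠ 0 := Nat.cast_ne_zero.mpr hN0
    have hP1 : powSum p (avg v N) ≤ 1 := by
      rw [← lpNorm_rpow h0]
      exact NNReal.rpow_le_one (lpNorm_avg_le hp hv N) h0.le
    refine ⟨f + avg v N, (hεf _ hP1 hNε).trans ?_, ⟨D + N, fun n => ?_⟩, ?_⟩
    · push_cast
      rw [mul_add, mul_one]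
      exact add_le_add_left hf _
    · obtain ⟨E, R, h, hE⟩ := hD n
      obtain ⟨E', R', h', hE'⟩ := exists_avg_mul_avg hp hv hN0 n
      refine ⟨E + E', R + R', ?_, ?_⟩
      · rw [add_mul, add_add_add_comm, h, h', Nat.cast_succ, add_smul, one_smul,
          add_add_add_comm]
      · rw [add_mul]
        exact (lpNorm_add_le hp _ _).trans (add_le_add hE hE')
    · rw [Finset.sum_range_succ]
      have hexp : (f + avg v N) * (f + avg v N) =
          f * f + f * avg v N + (avg v N * f + avg v N * avg v N) := by
        rw [add_mul, mul_add, mul_add]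
      rw [hexp]
      -- Only `f * f` and `f * avg v N` are kept; the other two products are nonnegative and
      -- dropped.
      refine le_trans (add_le_add hff ?_) ((powSum_add_ge hp _ _).trans
        (powSum_le_of_add_eq hp rfl))
      rw [← lpNorm_rpow h0]
      refine NNReal.rpow_le_rpow (tsub_le_iff_right.mpr ?_) h0.le
      obtain ⟨E, R, h, hE⟩ := hD N
      have hE1 : lpNorm p E ≤ 1 / C := by
        refine hE.trans ?_
        rw [← div_eq_mul_inv, div_le_div_iff₀ (by positivity) (by positivity), one_mul, mul_comm]
        exact hn₀.trans (Nat.cast_le.mpr (by omega))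
      have hw : (1 : ℝ≥0) / C ≤ lpNorm p (avg v N) := by
        rw [div_le_iff₀ (by positivity), mul_comm]
        exact one_le_lpNorm_avg hp hC hv hv' hN0
      calc (j : ℝ≥0) / C = j * (1 / C) := by ring
        _ ≤ j * lpNorm p (avg v N) := mul_le_mul_right hw _
        _ = lpNorm p ((j : ℝ≥0) • avg v N) := (lpNorm_smul h0 _ _).symm
        _ ≤ lpNorm p ((j : ℝ≥0) • avg v N + R) := lpNorm_le_add hp _ _
        _ = lpNorm p (f * avg v N + E) := by rw [h]
        _ ≤ lpNorm p (f * avg v N) + 1 / C :=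
          (lpNorm_add_le hp _ _).trans (add_le_add_right hE1 _)

theorem powSum_mul_le (hp : 0 < p)
    (hC : ∀ f g : MonoidAlgebra ℝ≥0 G, lpNorm p (f * g) ≤ C * lpNorm p f * lpNorm p g)
    (f g : MonoidAlgebra ℝ≥0 G) : powSum p (f * g) ≤ C ^ p * powSum p f * powSum p g := by
  rw [← lpNorm_rpow hp, ← lpNorm_rpow hp f, ← lpNorm_rpow hp g, ← NNReal.mul_rpow,
    ← NNReal.mul_rpow]
  exact NNReal.rpow_le_rpow (hC f g) hp.le

theorem not_vanishing_averages (hp : 1 < p)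
    (hC : ∀ f g : MonoidAlgebra ℝ≥0 G, lpNorm p (f * g) ≤ C * lpNorm p f * lpNorm p g)
    (hv : ∀ n, lpNorm p (v ^ n) ≤ 1) (hv' : ∀ n, 1 ≤ C * lpNorm p (v ^ n))
    (hweak : ∀ (K : Finset G) (ε : ℝ≥0), 0 < ε → ∀ n₀ : ℕ, ∃ N, n₀ ≤ N ∧
      ∀ x ∈ K, (avg v N).coeff x ≤ ε) : False := by
  have h0 : 0 < p := by linarith
  have hC0 : C ≠ 0 := by rintro rfl; simpa using hv' 0
  have hbound : ∀ m : ℕ, 0 < m → (m : ℝ≥0) ^ (p - 1) ≤ 32 * C ^ p * C ^ p := by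
    intro m hm
    -- With `2 * (m + 1)` averages, the upper half of the sum has `m + 1` terms, each at least `(m /
    -- C) ^ p`. This order `m ^ (p + 1)` faces an upper bound of order `m ^ 2`.
    obtain ⟨f, hf, -, hff⟩ := exists_sparse_sum hp.le hC hv hv' hweak (2 * (m + 1))
    have hlow : ((m + 1 : ℕ) : ℝ≥0) * ((m : ℝ≥0) / C) ^ p ≤ powSum p (f * f) := by
      refine le_trans ?_ hff
      rw [two_mul, Finset.sum_range_add]
      refine le_trans ?_ le_add_self
      rw [← nsmul_eq_mul]
      nth_rw 1 [← Finset.card_range (m + 1)]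
      rw [← Finset.sum_const]
      refine Finset.sum_le_sum fun i _ => NNReal.rpow_le_rpow (le_tsub_of_add_le_right ?_) h0.le
      rw [← add_div]
      gcongr
      push_cast
      exact le_self_add
    have hup : powSum p (f * f) ≤ C ^ p * (4 * (m + 1 : ℕ)) * (4 * (m + 1 : ℕ)) := by
      refine (powSum_mul_le h0 hC f f).trans ?_
      have : powSum p f ≤ 4 * (m + 1 : ℕ) := hf.trans_eq (by push_cast; ring)
      gcongr
    have h1 := hlow.trans hup
    have h2 : ((m : ℝ≥0) / C) ^ p ≤ 32 * C ^ p * m := by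
      have h3 : ((m + 1 : ℕ) : ℝ≥0) * ((m : ℝ≥0) / C) ^ p ≤
          ((m + 1 : ℕ) : ℝ≥0) * (16 * C ^ p * (m + 1 : ℕ)) := h1.trans_eq (by ring)
      have h4 : ((m + 1 : ℕ) : ℝ≥0) ≤ 2 * m := by exact_mod_cast (by omega : m + 1 ≤ 2 * m)
      calc _ ≤ 16 * C ^ p * (m + 1 : ℕ) := le_of_mul_le_mul_left h3 (by positivity)
        _ ≤ 16 * C ^ p * (2 * m) := mul_le_mul_right h4 _
        _ = _ := by ring
    have hm' : (m : ℝ≥0) ≠ 0 := Nat.cast_ne_zero.mpr hm.ne'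
    rw [NNReal.div_rpow, div_le_iff₀ (NNReal.rpow_pos (pos_iff_ne_zero.mpr hC0))] at h2
    rw [NNReal.rpow_sub hm', NNReal.rpow_one, div_le_iff₀ (pos_iff_ne_zero.mpr hm')]
    exact h2.trans_eq (by ring)
  have htend : Tendsto (fun m : ℕ => (m : ℝ≥0) ^ (p - 1)) atTop atTop :=
    (NNReal.tendsto_rpow_atTop (by linarith)).comp tendsto_natCast_atTop_atTop
  obtain ⟨m, hm, hm0⟩ := ((htend.eventually_gt_atTop (32 * C ^ p * C ^ p)).and
    (eventually_gt_atTop 0)).exists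
  exact (hbound m hm0).not_gt hm

end Averages

/-! ### Unboundedness of `ℓ^p` convolution on infinite discrete groups -/

section Discrete

open MonoidAlgebra Filter Topology

variable {G : Type*} {p : ℝ} {C : ℝ≥0} [Group G]

theorem mul_avg_add (v : MonoidAlgebra ℝ≥0 G) (N : ℕ) :
    v * avg v N + (N : ℝ≥0)⁻¹ • (1 : MonoidAlgebra ℝ≥0 G) =
      avg v N + (N : ℝ≥0)⁻¹ • v ^ N := by
  have h := pow_mul_geom_add v 1 N
  have h1 : geom v 1 = 1 := by simp [geom]
  rw [h1, pow_one, mul_one] at h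
  rw [avg, mul_smul_comm, ← smul_add, h, smul_add]

/-- On an infinite group, the averages of the powers of the normalised indicator function of a
symmetric generating set vanish at infinity. -/
theorem avg_vanishes [Infinite G] (hp1 : 1 ≤ p) (hp2 : p ≤ 2) {S : Finset G} {r : ℝ≥0}
    (hr : 0 < r) (hinv : ∀ s ∈ S, s⁻¹ ∈ S) (hgen : Subgroup.closure (S : Set G) = ⊤)
    {v : MonoidAlgebra ℝ≥0 G} (hvS : v = r⁻¹ • ∑ s ∈ S, single s 1)
    (hv : ∀ n, lpNorm p (v ^ n) ≤ 1) (K : Finset G) (ε : ℝ≥0) (hε : 0 < ε) (n₀ : ℕ) :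
    ∃ N, n₀ ≤ N ∧ ∀ x ∈ K, (avg v N).coeff x ≤ ε := by
  have h0 : 0 < p := by linarith
  have hle1 : ∀ N x, (avg v N).coeff x ≤ 1 := fun N x =>
    (coeff_le_lpNorm h0 _ x).trans (lpNorm_avg_le hp1 hv N)
  -- Coefficients lie in `[0, 1]`, so limits along a free ultrafilter exist at all points
  -- simultaneously.
  have hlim : ∀ x, ∃ a : ℝ, Tendsto (fun N => ((avg v N).coeff x : ℝ)) (hyperfilter ℕ) (𝓝 a) := by
    intro x
    obtain ⟨a, -, ha⟩ := (isCompact_Icc (a := (0 : ℝ)) (b := 1)).ultrafilter_le_nhds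
      ((hyperfilter ℕ).map fun N => ((avg v N).coeff x : ℝ))
      (by
        rw [le_principal_iff, Ultrafilter.mem_coe, Ultrafilter.mem_map]
        exact Filter.univ_mem' fun N => ⟨NNReal.coe_nonneg _, NNReal.coe_le_one.mpr (hle1 N x)⟩)
    exact ⟨a, ha⟩
  choose φ hφ using hlim
  have hφ0 : ∀ x, 0 ≤ φ x := fun x =>
    ge_of_tendsto' (hφ x) fun N => NNReal.coe_nonneg _
  -- Here `p ≤ 2` enters: coefficients are at most `1`, so their squares are bounded by their `p`-th
  -- powers.
  have hsum : Summable fun x => φ x ^ 2 := by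
    refine summable_of_sum_le (c := 1) (fun x => sq_nonneg _) fun T => ?_
    refine le_of_tendsto' (tendsto_finsetSum T fun x _ => (hφ x).pow 2) fun N => ?_
    have h1 : ∑ x ∈ T, (avg v N).coeff x ^ p ≤ 1 := by
      refine (sum_le_powSum h0 _ T).trans ?_
      rw [← lpNorm_rpow h0]
      exact NNReal.rpow_le_one (lpNorm_avg_le hp1 hv N) h0.le
    have h2 : ∑ x ∈ T, (avg v N).coeff x ^ 2 ≤ 1 := by
      refine (Finset.sum_le_sum fun x _ => ?_).trans h1
      rw [← NNReal.rpow_two]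
      rcases eq_zero_or_pos ((avg v N).coeff x) with h | h
      · rw [h, NNReal.zero_rpow h0.ne', NNReal.zero_rpow two_ne_zero]
      · exact NNReal.rpow_le_rpow_of_exponent_ge h (hle1 N x) hp2
    exact_mod_cast h2
  have hinvN : Tendsto (fun N : ℕ => ((N : ℝ))⁻¹) (hyperfilter ℕ) (𝓝 0) :=
    (tendsto_inv_atTop_nhds_zero_nat (𝕜 := ℝ)).mono_left Nat.hyperfilter_le_atTop
  have hbdd : ∀ (f : ℕ → MonoidAlgebra ℝ≥0 G) (z : G), (∀ N, lpNorm p (f N) ≤ 1) →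
      Tendsto (fun N : ℕ => (N : ℝ)⁻¹ * ((f N).coeff z : ℝ)) (hyperfilter ℕ) (𝓝 0) := by
    intro f z hf
    refine squeeze_zero (fun N => by positivity) (fun N => ?_) hinvN
    exact mul_le_of_le_one_right (by positivity)
      (NNReal.coe_le_one.mpr ((coeff_le_lpNorm h0 _ z).trans (hf N)))
  have heig : ∀ z, ∑ s ∈ S, φ (s⁻¹ * z) = r * φ z := by
    intro z
    -- `v * A_N` and `A_N` differ by `(v ^ N - 1) / N`, which vanishes pointwise in the limit.
    have hmul : ∀ N : ℕ, (r : ℝ)⁻¹ * ∑ s ∈ S, ((avg v N).coeff (s⁻¹ * z) : ℝ) +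
        (N : ℝ)⁻¹ * ((1 : MonoidAlgebra ℝ≥0 G).coeff z : ℝ) =
        ((avg v N).coeff z : ℝ) + (N : ℝ)⁻¹ * ((v ^ N).coeff z : ℝ) := by
      intro N
      have h := congrArg (fun f : MonoidAlgebra ℝ≥0 G => (f.coeff z : ℝ)) (mul_avg_add v N)
      have h2 : (v * avg v N).coeff z = r⁻¹ * ∑ s ∈ S, (avg v N).coeff (s⁻¹ * z) := by
        nth_rw 1 [hvS]
        rw [smul_mul_assoc, coeff_smul_apply, Finset.sum_mul, coeff_sum, Finsupp.finsetSum_apply,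
          smul_eq_mul]
        simp_rw [coeff_single_mul_apply, one_mul]
      simp only [coeff_add, Finsupp.add_apply, coeff_smul_apply, smul_eq_mul, h2,
        NNReal.coe_add, NNReal.coe_mul, NNReal.coe_inv, NNReal.coe_sum, NNReal.coe_natCast] at h
      exact h
    have hl := ((tendsto_finsetSum S fun s _ => hφ (s⁻¹ * z)).const_mul (r : ℝ)⁻¹).add
      (hbdd (fun _ => 1) z fun _ => (lpNorm_one h0).le)
    have hr' := (hφ z).add (hbdd (fun N => v ^ N) z hv)
    simp_rw [hmul] at hl
    have := tendsto_nhds_unique hl hr'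
    rw [add_zero, add_zero, inv_mul_eq_iff_eq_mul₀ (NNReal.coe_ne_zero.mpr hr.ne')] at this
    exact this
  have hzero := eigen_eq_zero (NNReal.coe_pos.mpr hr) hφ0 hsum hinv hgen heig
  have hev : ∀ᶠ N in (hyperfilter ℕ : Filter ℕ), ∀ x ∈ K, (avg v N).coeff x ≤ ε := by
    rw [Filter.eventually_all_finset]
    intro x _
    have h := hφ x
    rw [hzero] at h
    exact (h.eventually_lt_const (NNReal.coe_pos.mpr hε)).mono fun N hN =>
      NNReal.coe_le_coe.mp hN.le
  obtain ⟨N, h1, h2⟩ :=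
    (((eventually_ge_atTop n₀).filter_mono Nat.hyperfilter_le_atTop).and hev).exists
  exact ⟨N, h1, h2⟩

theorem not_bounded_mul_of_fg [Infinite G] [Group.FG G] (hp1 : 1 < p) (hp2 : p ≤ 2)
    (hC : ∀ f g : MonoidAlgebra ℝ≥0 G, lpNorm p (f * g) ≤ C * lpNorm p f * lpNorm p g) :
    False := by
  classical
  have h0 : 0 < p := by linarith
  obtain ⟨S₀, hS₀, hfin⟩ := Group.fg_iff.mp ‹Group.FG G›
  lift S₀ to Finset G using hfin
  obtain ⟨S, hS⟩ : ∃ S : Finset G, S = insert 1 (S₀ ∪ S₀.image (·⁻¹)) := ⟨_, rfl⟩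
  have h1S : 1 ∈ S := hS ▸ Finset.mem_insert_self _ _
  have hinv : ∀ s ∈ S, s⁻¹ ∈ S := by
    intro s hs
    simp only [hS, Finset.mem_insert, Finset.mem_union, Finset.mem_image] at hs ⊢
    rcases hs with rfl | hs | ⟨t, ht, rfl⟩
    · exact Or.inl inv_one
    · exact Or.inr (Or.inr ⟨s, hs, rfl⟩)
    · exact Or.inr (Or.inl (by rwa [inv_inv]))
  have hgen : Subgroup.closure (S : Set G) = ⊤ := by
    rw [eq_top_iff, ← hS₀]
    refine Subgroup.closure_mono fun x hx => ?_
    simp only [hS, Finset.mem_coe, Finset.mem_insert, Finset.mem_union]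
    exact Or.inr (Or.inl hx)
  obtain ⟨u, hu⟩ : ∃ u : MonoidAlgebra ℝ≥0 G, u = ∑ s ∈ S, single s 1 := ⟨_, rfl⟩
  have hu1 : 0 < lpNorm p u := by
    refine lt_of_lt_of_le ?_ (coeff_le_lpNorm h0 u 1)
    rw [hu, coeff_sum, Finsupp.finsetSum_apply]
    refine Finset.sum_pos' (fun _ _ => zero_le) ⟨1, h1S, ?_⟩
    rw [coeff_single, Finsupp.single_eq_same]
    exact zero_lt_one
  have hpos : ∀ n, 0 < lpNorm p (u ^ n) := by
    intro n
    induction n with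
    | zero => rw [pow_zero, lpNorm_one h0]; exact zero_lt_one
    | succ n ih => rw [pow_succ]; exact (mul_pos ih hu1).trans_le (lpNorm_mul_ge hp1.le _ _)
  have hC1 : 1 ≤ C := by
    have := hC 1 1
    rwa [mul_one, lpNorm_one h0, mul_one, mul_one] at this
  obtain ⟨ρ, hρ, hbd⟩ := exists_growth_rate (a := fun n => (lpNorm p (u ^ n) : ℝ)) (C := C)
    (by rw [pow_zero, lpNorm_one h0, NNReal.coe_one]) hpos hC1
    (fun m n => by rw [pow_add]; exact_mod_cast lpNorm_mul_ge hp1.le (u ^ m) (u ^ n))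
    (fun m n => by rw [pow_add]; exact_mod_cast hC (u ^ m) (u ^ n))
  lift ρ to ℝ≥0 using hρ.le
  have hρ' : 0 < ρ := hρ
  have hpow : ∀ n, lpNorm p ((ρ⁻¹ • u) ^ n) = (ρ ^ n)⁻¹ * lpNorm p (u ^ n) := fun n => by
    rw [smul_pow, lpNorm_smul h0, inv_pow]
  have hv : ∀ n, lpNorm p ((ρ⁻¹ • u) ^ n) ≤ 1 := fun n => by
    rw [hpow, inv_mul_le_iff₀ (by positivity), mul_one]
    exact_mod_cast (hbd n).1
  have hv' : ∀ n, 1 ≤ C * lpNorm p ((ρ⁻¹ • u) ^ n) := fun n => by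
    rw [hpow, mul_left_comm, ← div_eq_inv_mul, one_le_div (by positivity)]
    exact_mod_cast (hbd n).2
  exact not_vanishing_averages hp1 hC hv hv'
    (avg_vanishes hp1.le hp2 hρ' hinv hgen (hu ▸ rfl) hv)

theorem bounded_mul_subgroup (H : Subgroup G)
    (hC : ∀ f g : MonoidAlgebra ℝ≥0 G, lpNorm p (f * g) ≤ C * lpNorm p f * lpNorm p g)
    (f g : MonoidAlgebra ℝ≥0 H) : lpNorm p (f * g) ≤ C * lpNorm p f * lpNorm p g := by
  have h : ∀ f : MonoidAlgebra ℝ≥0 H,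
      lpNorm p f = lpNorm p (mapDomainRingHom ℝ≥0 H.subtype f) := fun f => by
    rw [lpNorm, lpNorm]
    congr 1
    exact (powSum_mapDomain Subtype.val_injective f).symm
  rw [h, h f, h g, map_mul]
  exact hC _ _

/-- The constant function `1` satisfies `f * f = |G| • f`, and boundedness is tested on it. -/
theorem card_rpow_le [Fintype G] (hp : 1 < p)
    (hC : ∀ f g : MonoidAlgebra ℝ≥0 G, lpNorm p (f * g) ≤ C * lpNorm p f * lpNorm p g) :
    (Fintype.card G : ℝ≥0) ^ (p - 1) ≤ C ^ p := by
  classical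
  have h0 : 0 < p := by linarith
  obtain ⟨f, hf⟩ : ∃ f : MonoidAlgebra ℝ≥0 G, f = ∑ s, single s 1 := ⟨_, rfl⟩
  have hcoeff : ∀ x, f.coeff x = 1 := fun x => by
    simp [hf, coeff_sum, Finsupp.finsetSum_apply, Finsupp.single_apply]
  have hff : f * f = (Fintype.card G : ℝ≥0) • f := by
    nth_rw 1 [hf]
    rw [Finset.sum_mul]
    have : ∀ x : G, single x 1 * f = f := fun x => by
      refine coeff_injective (Finsupp.ext fun y => ?_)
      rw [coeff_single_mul_apply, hcoeff, hcoeff, one_mul]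
    simp_rw [this]
    rw [Finset.sum_const, Nat.cast_smul_eq_nsmul, Finset.card_univ]
  have hP : powSum p f = Fintype.card G := by
    rw [powSum_eq_sum h0 f (Finset.subset_univ _)]
    simp [hcoeff]
  have h := powSum_mul_le h0 hC f f
  have hc : 0 < (Fintype.card G : ℝ≥0) := Nat.cast_pos.mpr Fintype.card_pos
  rw [hff, powSum_smul h0, hP] at h
  rw [NNReal.rpow_sub hc.ne', NNReal.rpow_one, div_le_iff₀ hc]
  exact le_of_mul_le_mul_right h hc

/-- If every finitely generated subgroup is finite, indicator functions of large finite subgroups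
show that convolution is not bounded. -/
theorem not_bounded_mul_of_locally_finite [Infinite G] (hp : 1 < p)
    (hC : ∀ f g : MonoidAlgebra ℝ≥0 G, lpNorm p (f * g) ≤ C * lpNorm p f * lpNorm p g)
    (hfin : ∀ S : Finset G, Finite (Subgroup.closure (S : Set G))) : False := by
  have htend : Tendsto (fun m : ℕ => (m : ℝ≥0) ^ (p - 1)) atTop atTop :=
    (NNReal.tendsto_rpow_atTop (by linarith)).comp tendsto_natCast_atTop_atTop
  obtain ⟨n, hn⟩ := (htend.eventually_gt_atTop (C ^ p)).exists
  obtain ⟨T, hT⟩ := Infinite.exists_subset_card_eq G n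
  have := hfin T
  have := Fintype.ofFinite (Subgroup.closure (T : Set G))
  refine (hn.trans_le ?_).not_ge
    (card_rpow_le (G := Subgroup.closure (T : Set G)) hp (bounded_mul_subgroup _ hC))
  refine NNReal.rpow_le_rpow (Nat.cast_le.mpr ?_) (by linarith)
  rw [← hT, ← Fintype.card_coe]
  exact Fintype.card_le_of_injective
    (fun x : T => (⟨x, Subgroup.subset_closure x.2⟩ : Subgroup.closure (T : Set G)))
    fun x y h => Subtype.ext (congrArg (fun z : Subgroup.closure (T : Set G) => (z : G)) h)

/-- On an infinite group, the `ℓ^p` norm with `1 < p ≤ 2` is not submultiplicative up to a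
constant. -/
theorem not_bounded_mul [Infinite G] (hp1 : 1 < p) (hp2 : p ≤ 2)
    (hC : ∀ f g : MonoidAlgebra ℝ≥0 G, lpNorm p (f * g) ≤ C * lpNorm p f * lpNorm p g) :
    False := by
  by_cases hfin : ∀ S : Finset G, Finite (Subgroup.closure (S : Set G))
  · exact not_bounded_mul_of_locally_finite hp1 hC hfin
  · push Not at hfin
    obtain ⟨S, hS⟩ := hfin
    exact not_bounded_mul_of_fg (G := Subgroup.closure (S : Set G)) hp1 hp2
      (bounded_mul_subgroup _ hC)

end Discrete

/-! ### Young's inequality for compactly supported functions -/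

section Young

open Measure Set Topology Filter
open scoped Pointwise

/-- In a locally compact Hausdorff space, functions in `L^p` are approximated by continuous
functions with compact support. -/
theorem exists_hasCompactSupport_eLpNorm_sub_le {X : Type*} [TopologicalSpace X] [T2Space X]
    [LocallyCompactSpace X] [MeasurableSpace X] [BorelSpace X] {μ : Measure X} [μ.Regular]
    {p : ℝ≥0∞} (hp : p ≠ ∞) {f : X → ℂ} (hf : MemLp f p μ) {ε : ℝ≥0∞} (hε : ε ≠ 0) :
    ∃ g : X → ℂ, eLpNorm (f - g) p μ ≤ ε ∧ Continuous g ∧ HasCompactSupport g := by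
  apply hf.induction_dense hp _ _ _ _ hε
  rotate_left
  · rintro f g ⟨f_cont, hf⟩ ⟨g_cont, hg⟩
    exact ⟨f_cont.add g_cont, hf.add hg⟩
  · rintro f ⟨f_cont, -⟩
    exact f_cont.aestronglyMeasurable
  intro c t ht htμ ε hε
  obtain ⟨δ, δpos, hδ⟩ := exists_Lp_half ℂ μ p hε
  obtain ⟨η, ηpos, hη⟩ := exists_eLpNorm_indicator_le (μ := μ) hp c δpos.ne'
  have hη_pos' : (η : ℝ≥0∞) ≠ 0 := (ENNReal.coe_pos.2 ηpos).ne'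
  -- The indicator of `t` is replaced by that of a compact `s ⊆ t`, then by a bump which differs
  -- from it only on `V \ s`.
  obtain ⟨s, st, s_compact, s_closed, μs⟩ :
      ∃ s, s ⊆ t ∧ IsCompact s ∧ IsClosed s ∧ μ (t \ s) < η :=
    ht.exists_isCompact_isClosed_sdiff_lt htμ.ne hη_pos'
  obtain ⟨V, sV, V_open, -, hV⟩ : ∃ V : Set X, V ⊇ s ∧ IsOpen V ∧ μ V < ∞ ∧ μ (V \ s) < η :=
    s_closed.measurableSet.exists_isOpen_sdiff_lt s_compact.measure_lt_top.ne hη_pos'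
  obtain ⟨g, g_one, g_zero, g_supp, g_range⟩ :=
    exists_continuous_one_zero_of_isCompact s_compact V_open.isClosed_compl
      (disjoint_compl_right_iff_subset.2 sV)
  have g_cont : Continuous fun x => g x • c := by fun_prop
  have I1 : eLpNorm ((s.indicator fun _ => c) - t.indicator fun _ => c) p μ ≤ δ := by
    rw [← eLpNorm_neg, neg_sub, ← indicator_sdiff st]
    exact hη _ μs.le
  have hbd : ∀ x, ‖g x • c - s.indicator (fun _ => c) x‖ ≤ ‖(V \ s).indicator (fun _ => c) x‖ := by
    intro x
    by_cases hs : x ∈ s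
    · simp [g_one hs, hs]
    · by_cases hv : x ∈ V
      · have : |g x| ≤ 1 := abs_le.2 ⟨by linarith [(g_range x).1], (g_range x).2⟩
        simpa [hs, hv] using mul_le_of_le_one_left (norm_nonneg c) this
      · simp [g_zero hv, hs, hv]
  have I2 : eLpNorm ((fun x => g x • c) - s.indicator fun _ => c) p μ ≤ δ :=
    (eLpNorm_mono hbd).trans (hη _ hV.le)
  refine ⟨fun x => g x • c, ?_, g_cont, g_supp.smul_right⟩
  have I3 := (hδ _ _ (g_cont.aestronglyMeasurable.sub
      (aestronglyMeasurable_const.indicator s_closed.measurableSet))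
    ((aestronglyMeasurable_const.indicator s_closed.measurableSet).sub
      (aestronglyMeasurable_const.indicator ht)) I2 I1).le
  rwa [sub_add_sub_cancel] at I3

theorem hasCompactSupport_inv_mul {G E : Type*} [Group G] [TopologicalSpace G]
    [IsTopologicalGroup G] [Zero E] {f : G → E} (hf : HasCompactSupport f) (x : G) :
    HasCompactSupport fun y => f (y⁻¹ * x) :=
  hf.comp_homeomorph ((Homeomorph.inv G).trans (Homeomorph.mulRight x))

variable {G : Type*} [Group G] [TopologicalSpace G] [IsTopologicalGroup G]
    [MeasurableSpace G] [BorelSpace G]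

/-- A regular Haar measure on a unimodular group is invariant under inversion. -/
theorem isInvInvariant_of_isMulRightInvariant [LocallyCompactSpace G]
    (μ : Measure G) [μ.IsHaarMeasure] [μ.Regular] [μ.IsMulRightInvariant] :
    μ.IsInvInvariant := by
  constructor
  let c : ℝ≥0∞ := haarScalarFactor μ.inv μ
  -- Right invariance of `μ` makes `μ.inv` left invariant, so uniqueness of Haar measure applies;
  -- inverting twice gives `c ^ 2 = 1`.
  have hc : μ.inv = c • μ := isMulLeftInvariant_eq_smul_of_regular μ.inv μ
  have : map Inv.inv (map Inv.inv μ) = c ^ 2 • μ := by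
    rw [← inv_def μ, hc, Measure.map_smul, ← inv_def μ, hc, smul_smul, pow_two]
  have μeq : μ = c ^ 2 • μ := by
    rw [map_map continuous_inv.measurable continuous_inv.measurable] at this
    simpa only [inv_involutive, Function.Involutive.comp_self, Measure.map_id]
  have K : TopologicalSpace.PositiveCompacts G := Classical.arbitrary _
  have : c ^ 2 * μ K = 1 ^ 2 * μ K := by
    conv_rhs => rw [μeq]
    simp
  have : c ^ 2 = 1 ^ 2 :=
    (ENNReal.mul_left_inj (measure_pos_of_nonempty_interior _ K.interior_nonempty).ne'
          K.isCompact.measure_lt_top.ne).1 this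
  have : c = 1 := (ENNReal.pow_right_strictMono two_ne_zero).injective this
  rw [hc, this, one_smul]

variable {μ : Measure G}

theorem continuous_integral_mul [IsFiniteMeasureOnCompacts μ] {𝕜 : Type*} [RCLike 𝕜] {g f : G → 𝕜}
    (hg : Continuous g) (hg' : HasCompactSupport g) (hf : Continuous f) :
    Continuous fun x => ∫ y, g y * f (y⁻¹ * x) ∂μ := by
  rw [← continuousOn_univ]
  refine continuousOn_integral_of_compact_support (k := tsupport g) hg' ?_ ?_
  · exact ((hg.comp continuous_snd).mul
      (hf.comp (continuous_snd.inv.mul continuous_fst))).continuousOn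
  · intro x y _ hy
    rw [image_eq_zero_of_notMem_tsupport hy, zero_mul]

/-- Tonelli's theorem for the convolution of two continuous functions with compact support. -/
theorem lintegral_conv [T2Space G] [IsFiniteMeasureOnCompacts μ] [μ.IsMulLeftInvariant]
    {a b : G → ℝ} (ha : Continuous a) (ha' : HasCompactSupport a) (hb : Continuous b)
    (hb' : HasCompactSupport b) (ha0 : ∀ x, 0 ≤ a x) (hb0 : ∀ x, 0 ≤ b x) :
    ∫⁻ x, ∫⁻ y, ENNReal.ofReal (a y * b (y⁻¹ * x)) ∂μ ∂μ =
      (∫⁻ x, ENNReal.ofReal (a x) ∂μ) * ∫⁻ x, ENNReal.ofReal (b x) ∂μ := by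
  have hab : ∀ x, Continuous fun y => a y * b (y⁻¹ * x) := fun x =>
    ha.mul (hb.comp (continuous_inv.mul continuous_const))
  have hab0 : ∀ x y, 0 ≤ a y * b (y⁻¹ * x) := fun x y => mul_nonneg (ha0 _) (hb0 _)
  have hzero : ∀ x y, y ∉ tsupport a ∨ x ∉ tsupport a * tsupport b → a y * b (y⁻¹ * x) = 0 := by
    intro x y h
    by_cases hy : y ∈ tsupport a
    · have hx : y⁻¹ * x ∉ tsupport b := fun hx =>
        h.elim (fun h => h hy) fun h => h ⟨y, hy, y⁻¹ * x, hx, by simp⟩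
      rw [image_eq_zero_of_notMem_tsupport hx, mul_zero]
    · rw [image_eq_zero_of_notMem_tsupport hy, zero_mul]
  have hK : IsCompact (tsupport a * tsupport b) := ha'.isCompact.mul hb'.isCompact
  have hinner : ∀ x, ∫⁻ y, ENNReal.ofReal (a y * b (y⁻¹ * x)) ∂μ =
      ENNReal.ofReal (∫ y, a y * b (y⁻¹ * x) ∂μ) := fun x =>
    (ofReal_integral_eq_lintegral_ofReal
      ((hab x).integrable_of_hasCompactSupport ha'.mul_right)
      (ae_of_all _ (hab0 x))).symm
  simp_rw [hinner]
  -- Passing to Bochner integrals allows Fubini for continuous compactly supported functions, which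
  -- needs no σ-finiteness of `μ`.
  rw [← ofReal_integral_eq_lintegral_ofReal
      ((continuous_integral_mul ha ha' hb).integrable_of_hasCompactSupport
        (HasCompactSupport.intro hK fun x hx => by
          simp_rw [hzero x _ (Or.inr hx)]; exact integral_zero _ _))
      (ae_of_all _ fun x => integral_nonneg (hab0 x)),
    ← ofReal_integral_eq_lintegral_ofReal (ha.integrable_of_hasCompactSupport ha')
      (ae_of_all _ ha0),
    ← ofReal_integral_eq_lintegral_ofReal (hb.integrable_of_hasCompactSupport hb')
      (ae_of_all _ hb0), ← ENNReal.ofReal_mul (integral_nonneg ha0),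
    integral_integral_swap_of_hasCompactSupport]
  · congr 1
    simp_rw [integral_const_mul]
    simp_rw [integral_mul_left_eq_self b]
    rw [integral_mul_const]
  · exact (ha.comp continuous_snd).mul (hb.comp (continuous_snd.inv.mul continuous_fst))
  · refine HasCompactSupport.intro (hK.prod ha'.isCompact) ?_
    rintro ⟨x, y⟩ h
    rw [mem_prod, not_and_or] at h
    exact hzero x y h.symm

variable [IsFiniteMeasureOnCompacts μ] {p : ℝ≥0∞}

theorem convExistsAt_of_hasCompactSupport (hp1 : 1 < p) {g f : G → ℂ}
    (hg : MemLp g p μ) (hf : Continuous f) (hf' : HasCompactSupport f) (x : G) :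
    ConvExistsAt μ g f x := by
  have : p.HolderConjugate p.conjExponent := ENNReal.HolderConjugate.conjExponent hp1.le
  exact hg.integrable_mul (q := p.conjExponent)
    ((hf.comp (continuous_inv.mul continuous_const)).memLp_of_hasCompactSupport
      (hasCompactSupport_inv_mul hf' x))

theorem tendsto_conv (hp1 : 1 < p) {g f : G → ℂ} {u : ℕ → G → ℂ}
    (hg : MemLp g p μ) (hu : ∀ n, MemLp (u n) p μ)
    (hlim : Tendsto (fun n => eLpNorm (g - u n) p μ) atTop (𝓝 0))
    (hf : Continuous f) (hf' : HasCompactSupport f) (x : G) :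
    Tendsto (fun n => conv μ (u n) f x) atTop (𝓝 (conv μ g f x)) := by
  have : p.HolderConjugate p.conjExponent := ENNReal.HolderConjugate.conjExponent hp1.le
  have hfx : MemLp (fun y => f (y⁻¹ * x)) p.conjExponent μ :=
    (hf.comp (continuous_inv.mul continuous_const)).memLp_of_hasCompactSupport
      (hasCompactSupport_inv_mul hf' x)
  refine tendsto_integral_of_L1' _
    (convExistsAt_of_hasCompactSupport hp1 hg hf hf' x).aestronglyMeasurable
    (Eventually.of_forall fun n => convExistsAt_of_hasCompactSupport hp1 (hu n) hf hf' x) ?_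
  have hle : ∀ n, eLpNorm ((fun y => u n y * f (y⁻¹ * x)) - fun y => g y * f (y⁻¹ * x)) 1 μ ≤
      eLpNorm (g - u n) p μ * eLpNorm (fun y => f (y⁻¹ * x)) p.conjExponent μ := by
    intro n
    rw [eLpNorm_sub_comm]
    have := eLpNorm_smul_le_mul_eLpNorm (p := p) (q := p.conjExponent) (r := 1)
      hfx.aestronglyMeasurable (hg.sub (hu n)).aestronglyMeasurable
    refine le_trans (le_of_eq ?_) this
    congr 1
    ext y
    simp [sub_mul]
  refine tendsto_of_tendsto_of_tendsto_of_le_of_le tendsto_const_nhds ?_ (fun _ => zero_le) hle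
  simpa using ENNReal.Tendsto.mul_const hlim (Or.inr hfx.eLpNorm_ne_top)

variable [T2Space G] [μ.IsMulLeftInvariant] [μ.IsMulRightInvariant] [μ.IsInvInvariant]

/-- Young's inequality for continuous functions with compact support. -/
theorem eLpNorm_conv_le_of_hasCompactSupport (hp1 : 1 < p) (hp : p ≠ ∞) {g f : G → ℂ}
    (hg : Continuous g) (hg' : HasCompactSupport g) (hf : Continuous f)
    (hf' : HasCompactSupport f) :
    eLpNorm (conv μ g f) p μ ≤ eLpNorm g p μ * eLpNorm f 1 μ := by
  have hr1 : 1 < p.toReal := by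
    rw [← ENNReal.toReal_one]; exact (ENNReal.toReal_lt_toReal ENNReal.one_ne_top hp).mpr hp1
  have hr0 : 0 < p.toReal := by linarith
  set r := p.toReal with hr
  obtain ⟨q, hq⟩ : ∃ q, r.HolderConjugate q := ⟨_, Real.HolderConjugate.conjExponent hr1⟩
  set B := eLpNorm f 1 μ with hB
  -- Unimodularity is used here, through inversion and right invariance.
  have hBx : ∀ x, ∫⁻ y, ‖f (y⁻¹ * x)‖ₑ ∂μ = B := fun x => by
    rw [lintegral_inv_eq_self (μ := μ) fun y => ‖f (y * x)‖ₑ,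
      lintegral_mul_right_eq_self (μ := μ) (fun y => ‖f y‖ₑ), hB, eLpNorm_one_eq_lintegral_enorm]
  have hpoint : ∀ x, ‖conv μ g f x‖ₑ ^ r ≤
      (∫⁻ y, ‖g y‖ₑ ^ r * ‖f (y⁻¹ * x)‖ₑ ∂μ) * B ^ (r - 1) := by
    intro x
    have hfx : Continuous fun y => f (y⁻¹ * x) :=
      hf.comp (continuous_inv.mul continuous_const)
    -- Split `|f| = |f| ^ (1 / r) * |f| ^ (1 / q)` and apply Hölder, so that only the first factor
    -- meets `g`.
    have h1 : ‖conv μ g f x‖ₑ ≤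
        ∫⁻ y, (‖g y‖ₑ * ‖f (y⁻¹ * x)‖ₑ ^ (1 / r)) * ‖f (y⁻¹ * x)‖ₑ ^ (1 / q) ∂μ := by
      refine (enorm_integral_le_lintegral_enorm _).trans_eq (lintegral_congr fun y => ?_)
      rw [mul_assoc, ← ENNReal.rpow_add_of_nonneg _ _ hq.one_div_nonneg hq.symm.one_div_nonneg,
        one_div, one_div, hq.inv_add_inv_eq_one, ENNReal.rpow_one, enorm_mul]
    have h2 := h1.trans (ENNReal.lintegral_mul_le_Lp_mul_Lq μ hq
      (f := fun y => ‖g y‖ₑ * ‖f (y⁻¹ * x)‖ₑ ^ (1 / r))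
      (g := fun y => ‖f (y⁻¹ * x)‖ₑ ^ (1 / q))
      (hg.enorm.measurable.mul (hfx.enorm.measurable.pow_const _)).aemeasurable
      (hfx.enorm.measurable.pow_const _).aemeasurable)
    have h3 := ENNReal.rpow_le_rpow h2 hr0.le
    refine h3.trans_eq ?_
    rw [ENNReal.mul_rpow_of_nonneg _ _ hr0.le, ← ENNReal.rpow_mul, ← ENNReal.rpow_mul,
      one_div_mul_cancel hr0.ne', ENNReal.rpow_one]
    congr 1
    · refine lintegral_congr fun y => ?_
      rw [ENNReal.mul_rpow_of_nonneg _ _ hr0.le, ← ENNReal.rpow_mul, one_div_mul_cancel hr0.ne',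
        ENNReal.rpow_one]
    · simp_rw [← ENNReal.rpow_mul, one_div_mul_cancel hq.symm.ne_zero, ENNReal.rpow_one]
      rw [hBx, one_div_mul_eq_div, hq.div_conj_eq_sub_one]
  have hswap : ∫⁻ x, ∫⁻ y, ‖g y‖ₑ ^ r * ‖f (y⁻¹ * x)‖ₑ ∂μ ∂μ = (∫⁻ x, ‖g x‖ₑ ^ r ∂μ) * B := by
    have h := lintegral_conv (μ := μ) (a := fun x => ‖g x‖ ^ r) (b := fun x => ‖f x‖)
      (hg.norm.rpow_const fun _ => Or.inr hr0.le)
      (hg'.comp_left (g := fun z : ℂ => ‖z‖ ^ r) (by simp [hr0.ne'])) hf.norm hf'.norm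
      (fun x => by positivity) fun x => norm_nonneg _
    have e : ∀ z : ℂ, ENNReal.ofReal (‖z‖ ^ r) = ‖z‖ₑ ^ r := fun z => by
      rw [← ENNReal.ofReal_rpow_of_nonneg (norm_nonneg _) hr0.le, ofReal_norm]
    simp_rw [ENNReal.ofReal_mul (Real.rpow_nonneg (norm_nonneg _) _), e, ofReal_norm] at h
    rw [h, hB, eLpNorm_one_eq_lintegral_enorm]
  have hp0 : p ≠ 0 := (zero_lt_one.trans hp1).ne'
  have hpow : ∫⁻ x, ‖conv μ g f x‖ₑ ^ r ∂μ ≤ (∫⁻ x, ‖g x‖ₑ ^ r ∂μ) * B ^ r := by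
    refine (lintegral_mono hpoint).trans_eq ?_
    have hBtop : B ^ (r - 1) ≠ ∞ := ENNReal.rpow_ne_top_of_nonneg (by linarith)
      (hf.memLp_of_hasCompactSupport hf').eLpNorm_ne_top
    rw [lintegral_mul_const' _ _ hBtop, hswap, mul_assoc]
    congr 1
    nth_rw 1 [← ENNReal.rpow_one B]
    rw [← ENNReal.rpow_add_of_nonneg _ _ zero_le_one (by linarith), add_sub_cancel]
  rw [eLpNorm_eq_lintegral_rpow_enorm_toReal hp0 hp, eLpNorm_eq_lintegral_rpow_enorm_toReal hp0 hp,
    ← hr]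
  refine (ENNReal.rpow_le_rpow hpow (by positivity)).trans_eq ?_
  rw [ENNReal.mul_rpow_of_nonneg _ _ (by positivity), ← ENNReal.rpow_mul,
    mul_one_div_cancel hr0.ne', ENNReal.rpow_one]

end Young

/-! ### Young's inequality for general `g` in `L^p` -/

section YoungGeneral

open Measure Set Topology Filter

variable {G : Type*} [Group G] [TopologicalSpace G] [IsTopologicalGroup G]
  [LocallyCompactSpace G] [T2Space G] [MeasurableSpace G] [BorelSpace G] {μ : Measure G}
  [μ.Regular] [μ.IsMulLeftInvariant] [μ.IsMulRightInvariant] [μ.IsInvInvariant] {p : ℝ≥0∞}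

/-- Young's inequality for the convolution of a function in `L^p` with a continuous function with
compact support. -/
theorem young (hp1 : 1 < p) (hp : p ≠ ∞) {g f : G → ℂ}
    (hg : MemLp g p μ) (hf : Continuous f) (hf' : HasCompactSupport f) :
    AEStronglyMeasurable (conv μ g f) μ ∧
      eLpNorm (conv μ g f) p μ ≤ eLpNorm g p μ * eLpNorm f 1 μ := by
  have happrox : ∀ n : ℕ, ∃ u : G → ℂ,
      eLpNorm (g - u) p μ ≤ ((n : ℝ≥0∞) + 1)⁻¹ ∧ Continuous u ∧ HasCompactSupport u := fun n =>
    exists_hasCompactSupport_eLpNorm_sub_le hp hg (by simp)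
  choose u hu2 hu3 hu1 using happrox
  have hu4 : ∀ n, MemLp (u n) p μ := fun n => (hu3 n).memLp_of_hasCompactSupport (hu1 n)
  have hlim : Tendsto (fun n => eLpNorm (g - u n) p μ) atTop (𝓝 0) := by
    refine tendsto_of_tendsto_of_tendsto_of_le_of_le tendsto_const_nhds ?_
      (fun _ => zero_le) hu2
    have := (tendsto_add_atTop_iff_nat 1).mpr ENNReal.tendsto_inv_nat_nhds_zero
    simpa using this
  -- By Hölder the convolutions converge at every point. This gives measurability of the limit, and
  -- Fatou's lemma carries over the norm bound.
  have hconv := tendsto_conv hp1 hg hu4 hlim hf hf'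
  have hmeas : ∀ n, AEStronglyMeasurable (conv μ (u n) f) μ := fun n =>
    (continuous_integral_mul (hu3 n) (hu1 n) hf).aestronglyMeasurable
  refine ⟨aestronglyMeasurable_of_tendsto_ae _ hmeas (ae_of_all _ hconv), ?_⟩
  refine (Lp.eLpNorm_lim_le_liminf_eLpNorm hmeas _ (ae_of_all _ hconv)).trans ?_
  have hnorm : Tendsto (fun n => (eLpNorm g p μ + eLpNorm (g - u n) p μ) * eLpNorm f 1 μ) atTop
      (𝓝 (eLpNorm g p μ * eLpNorm f 1 μ)) := by
    have h := ENNReal.Tendsto.mul_const (hlim.const_add (eLpNorm g p μ))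
      (b := eLpNorm f 1 μ) (Or.inr (hf.memLp_of_hasCompactSupport hf').eLpNorm_ne_top)
    simpa using h
  rw [← hnorm.liminf_eq]
  refine liminf_le_liminf (Eventually.of_forall fun n => ?_)
  refine (eLpNorm_conv_le_of_hasCompactSupport hp1 hp (hu3 n) (hu1 n) hf hf').trans ?_
  gcongr
  have h := eLpNorm_sub_le hg.aestronglyMeasurable
    (hg.sub (hu4 n)).aestronglyMeasurable hp1.le
  rwa [sub_sub_cancel] at h

theorem normT_le_eLpNorm_one (hp1 : 1 < p) (hp : p ≠ ∞)
    {f : G → ℂ} (hf : Continuous f) (hf' : HasCompactSupport f) :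
    normT μ p f ≤ eLpNorm f 1 μ := by
  refine iSup₂_le fun g hg => (young hp1 hp hg.1 hf hf').2.trans ?_
  exact mul_le_of_le_one_left' hg.2

theorem mem_space_of_hasCompactSupport (hp1 : 1 < p)
    (hp : p ≠ ∞) {f : G → ℂ} (hf : Continuous f) (hf' : HasCompactSupport f) :
    f ∈ space μ p := by
  have h1 : eLpNorm f 1 μ < ∞ := (hf.memLp_of_hasCompactSupport hf').eLpNorm_lt_top
  refine ⟨hf.memLp_of_hasCompactSupport hf', fun g hg =>
    ⟨ae_of_all _ (convExistsAt_of_hasCompactSupport hp1 hg hf hf'), ?_⟩,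
    (normT_le_eLpNorm_one hp1 hp hf hf').trans_lt h1⟩
  exact ⟨(young hp1 hp hg hf hf').1, (young hp1 hp hg hf hf').2.trans_lt
    (ENNReal.mul_lt_top hg.eLpNorm_lt_top h1)⟩

end YoungGeneral

/-! ### The operator norm bound and discreteness -/

section Equivalence

open Measure Set Topology Filter

variable {G : Type*} [Group G] [MeasurableSpace G] {μ : Measure G} {p : ℝ≥0∞}

/-- `‖f‖_p^T` is an operator norm. -/
theorem eLpNorm_conv_le_normT_mul {g f : G → ℂ} (hp0 : p ≠ 0) (hg : MemLp g p μ) :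
    eLpNorm (conv μ g f) p μ ≤ normT μ p f * eLpNorm g p μ := by
  rcases eq_or_ne (eLpNorm g p μ) 0 with h0 | h0
  · have hg0 : g =ᵐ[μ] 0 := (eLpNorm_eq_zero_iff hg.aestronglyMeasurable hp0).mp h0
    have hconv : conv μ g f = 0 := by
      ext x
      refine integral_eq_zero_of_ae ?_
      filter_upwards [hg0] with y hy
      simp [hy]
    rw [hconv, eLpNorm_zero]
    exact zero_le
  · obtain ⟨t, ht⟩ : ∃ t : ℝ≥0, (t : ℝ≥0∞) = eLpNorm g p μ :=
      ⟨_, ENNReal.coe_toNNReal hg.eLpNorm_ne_top⟩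
    have ht0 : t ≠ 0 := fun h => h0 (by rw [← ht, h, ENNReal.coe_zero])
    have hscale : ∀ h : G → ℂ, eLpNorm (((t⁻¹ : ℝ≥0) : ℂ) • h) p μ =
        (t : ℝ≥0∞)⁻¹ * eLpNorm h p μ := fun h => by
      rw [eLpNorm_const_smul, ← ENNReal.coe_inv ht0]
      congr 1
      rw [← ofReal_norm, Complex.norm_real, NNReal.norm_eq, ENNReal.ofReal_coe_nnreal]
    have hmem : ((t⁻¹ : ℝ≥0) : ℂ) • g ∈ {g : G → ℂ | MemLp g p μ ∧ eLpNorm g p μ ≤ 1} := by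
      refine ⟨hg.const_smul _, ?_⟩
      rw [hscale, ← ht, ENNReal.inv_mul_cancel (by simpa using ht0) ENNReal.coe_ne_top]
    have hle : eLpNorm (conv μ (((t⁻¹ : ℝ≥0) : ℂ) • g) f) p μ ≤ normT μ p f :=
      le_iSup₂ (f := fun (g : G → ℂ) (_ : g ∈ {g : G → ℂ | MemLp g p μ ∧ eLpNorm g p μ ≤ 1}) =>
        eLpNorm (conv μ g f) p μ) _ hmem
    have hconv : conv μ (((t⁻¹ : ℝ≥0) : ℂ) • g) f = ((t⁻¹ : ℝ≥0) : ℂ) • conv μ g f := by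
      ext x
      simp only [conv, Pi.smul_apply, smul_eq_mul, mul_assoc]
      exact integral_const_mul _ _
    rw [hconv, hscale, ENNReal.inv_mul_le_iff (by simpa using ht0) ENNReal.coe_ne_top] at hle
    rw [← ht, mul_comm]
    exact hle

variable [TopologicalSpace G] [IsTopologicalGroup G] [LocallyCompactSpace G] [T2Space G]
  [BorelSpace G]

/-- If the `L^p` norm with `1 < p < ∞` is dominated by the `L^1` norm on continuous functions with
compact support, then the group is discrete. -/
theorem discreteTopology_of_eLpNorm_le [μ.IsHaarMeasure] [μ.Regular] (hp1 : 1 < p) (hp : p ≠ ∞)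
    {C : ℝ≥0} (hC : ∀ f : G → ℂ, Continuous f → HasCompactSupport f →
      eLpNorm f p μ ≤ C * eLpNorm f 1 μ) : DiscreteTopology G := by
  have hr1 : 1 < p.toReal := by
    rw [← ENNReal.toReal_one]; exact (ENNReal.toReal_lt_toReal ENNReal.one_ne_top hp).mpr hp1
  have hp0 : p ≠ 0 := (zero_lt_one.trans hp1).ne'
  have hs : 0 < 1 - 1 / p.toReal := by
    rw [sub_pos, div_lt_one (by linarith)]; exact hr1
  by_contra hdisc
  have hne : (𝓝[≠] (1 : G)).NeBot := by
    refine neBot_iff.mpr fun h => hdisc ?_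
    exact discreteTopology_of_isOpen_singleton_one (isOpen_singleton_iff_punctured_nhds _ |>.mpr h)
  have hnull : μ {1} = 0 := (IsHaarMeasure.nullSingletonClass μ).measure_singleton 1
  have hsmall : ∀ᶠ δ : ℝ≥0∞ in 𝓝 0, C * δ ^ (1 - 1 / p.toReal) < 1 := by
    have hcont : Continuous fun δ : ℝ≥0∞ => C * δ ^ (1 - 1 / p.toReal) :=
      (ENNReal.continuous_const_mul ENNReal.coe_ne_top).comp ENNReal.continuous_rpow_const
    refine (hcont.tendsto 0).eventually_lt_const ?_
    rw [ENNReal.zero_rpow_of_pos hs, mul_zero]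
    exact zero_lt_one
  obtain ⟨δ, hδ, hδ0⟩ := ((hsmall.filter_mono nhdsWithin_le_nhds).and
    (self_mem_nhdsWithin : Ioi (0 : ℝ≥0∞) ∈ 𝓝[>] 0)).exists
  obtain ⟨V, hV1, hVo, hVδ⟩ := Set.exists_isOpen_lt_of_lt {(1 : G)} δ (hnull.trans_lt hδ0)
  obtain ⟨φ, φ_one, φ_zero, φ_supp, -⟩ :=
    exists_continuous_one_zero_of_isCompact (isCompact_singleton (x := (1 : G)))
      hVo.isClosed_compl (disjoint_compl_right_iff_subset.2 hV1)
  obtain ⟨f, hf⟩ : ∃ f : G → ℂ, f = fun x => (φ x : ℂ) := ⟨_, rfl⟩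
  have f_cont : Continuous f := hf ▸ Complex.continuous_ofReal.comp φ.continuous
  have f_supp : HasCompactSupport f := hf ▸ φ_supp.comp_left Complex.ofReal_zero
  have f_one : f 1 ≠ 0 := by simp [hf, φ_one (mem_singleton (1 : G))]
  have f_sub : Function.support f ⊆ V := by
    intro x hx
    by_contra hxV
    exact hx (by simp [hf, φ_zero hxV])
  -- Hölder on `V`: the factor `μ V ^ (1 - 1 / p)` is small since a non-discrete group has null
  -- points.
  have h1 : eLpNorm f 1 μ ≤ eLpNorm f p μ * μ V ^ (1 - 1 / p.toReal) := by
    have h := eLpNorm_le_eLpNorm_mul_rpow_measure_univ (μ := μ.restrict V) hp1.le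
      f_cont.aestronglyMeasurable
    rwa [eLpNorm_restrict_eq_of_support_subset f_sub,
      eLpNorm_restrict_eq_of_support_subset f_sub, restrict_apply_univ, ENNReal.toReal_one,
      div_one] at h
  have hfin : eLpNorm f p μ ≠ ∞ := (f_cont.memLp_of_hasCompactSupport f_supp).eLpNorm_ne_top
  have hpos : eLpNorm f p μ ≠ 0 := fun h => by
    rw [eLpNorm_eq_zero_iff f_cont.aestronglyMeasurable hp0] at h
    exact f_one (congrFun ((f_cont.ae_eq_iff_eq μ continuous_zero).mp h) 1)
  have h2 : eLpNorm f p μ ≤ eLpNorm f p μ * (C * δ ^ (1 - 1 / p.toReal)) :=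
    calc eLpNorm f p μ ≤ C * eLpNorm f 1 μ := hC f f_cont f_supp
      _ ≤ C * (eLpNorm f p μ * δ ^ (1 - 1 / p.toReal)) := by
        gcongr
        exact h1.trans (by gcongr)
      _ = _ := by ring
  have h3 : eLpNorm f p μ * (C * δ ^ (1 - 1 / p.toReal)) < eLpNorm f p μ * 1 :=
    (ENNReal.mul_lt_mul_iff_right hpos hfin).mpr hδ
  rw [mul_one] at h3
  exact h2.not_gt h3

end Equivalence

/-! ### Transfer from the monoid algebra to the discrete group -/

section Discrete

open Measure MonoidAlgebra

variable {G : Type*} [Group G]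

/-- The coefficients of an element of the monoid algebra, as a complex function. -/
noncomputable def coeffFun {G : Type*} (f : MonoidAlgebra ℝ≥0 G) (x : G) : ℂ :=
  ((f.coeff x : ℝ≥0) : ℝ)

theorem coeff_mul_eq_sum (f g : MonoidAlgebra ℝ≥0 G) (x : G) :
    (f * g).coeff x = ∑ y ∈ f.coeff.support, f.coeff y * g.coeff (y⁻¹ * x) := by
  have h : f = ∑ y ∈ f.coeff.support, single y (f.coeff y) := by
    refine coeff_injective ?_
    simp only [coeff_sum, coeff_single]
    exact f.coeff.sum_single.symm
  conv_lhs => rw [h, Finset.sum_mul, coeff_sum, Finsupp.finsetSum_apply]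
  simp_rw [coeff_single_mul_apply]

theorem coeffFun_eq_zero {G : Type*} (f : MonoidAlgebra ℝ≥0 G) {x : G} (hx : x ∉ f.coeff.support) :
    coeffFun f x = 0 := by
  rw [coeffFun, Finsupp.notMem_support_iff.mp hx, NNReal.coe_zero, Complex.ofReal_zero]

variable [TopologicalSpace G] [IsTopologicalGroup G] [T2Space G] [MeasurableSpace G]
  [BorelSpace G] {μ : Measure G} [μ.IsHaarMeasure] {p : ℝ≥0∞}

theorem eLpNorm_coeffFun (hp0 : p ≠ 0) (hp : p ≠ ∞) (f : MonoidAlgebra ℝ≥0 G) :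
    eLpNorm (coeffFun f) p μ = μ {1} ^ (1 / p.toReal) * lpNorm p.toReal f := by
  have hr : 0 < p.toReal := ENNReal.toReal_pos hp0 hp
  have henorm : ∀ x, ‖coeffFun f x‖ₑ = f.coeff x := fun x => by
    rw [coeffFun, ← ofReal_norm, Complex.norm_real, NNReal.norm_eq, ENNReal.ofReal_coe_nnreal]
  have hint : ∫⁻ x, ‖coeffFun f x‖ₑ ^ p.toReal ∂μ = μ {1} * powSum p.toReal f := by
    rw [← setLIntegral_eq_of_support_subset (s := (f.coeff.support : Set G)), lintegral_finset,
      powSum_eq_sum hr f subset_rfl, ENNReal.ofNNReal_finsetSum, Finset.mul_sum]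
    · refine Finset.sum_congr rfl fun x _ => ?_
      rw [haar_singleton, mul_comm, henorm, ENNReal.coe_rpow_of_nonneg _ hr.le]
    · intro x hx
      by_contra hxs
      exact hx (by simp [coeffFun_eq_zero f hxs, hr])
  rw [eLpNorm_eq_lintegral_rpow_enorm_toReal hp0 hp, hint,
    ENNReal.mul_rpow_of_nonneg _ _ (by positivity), lpNorm,
    ENNReal.coe_rpow_of_nonneg _ (by positivity)]

theorem conv_coeffFun (f g : MonoidAlgebra ℝ≥0 G) :
    conv μ (coeffFun f) (coeffFun g) = (μ.real {1} : ℂ) • coeffFun (f * g) := by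
  ext x
  rw [conv, ← setIntegral_eq_integral_of_forall_compl_eq_zero (s := (f.coeff.support : Set G))
    fun y hy => by rw [coeffFun_eq_zero f hy, zero_mul]]
  have hint : IntegrableOn (fun y => coeffFun f y * coeffFun g (y⁻¹ * x))
      (f.coeff.support : Set G) μ := by
    rw [← Set.biUnion_of_singleton (f.coeff.support : Set G)]
    exact integrableOn_finset_iUnion.2 fun y _ =>
      integrableOn_singleton enorm_ne_top isCompact_singleton.measure_lt_top
  rw [setIntegral_finset _ hint]
  simp_rw [Measure.real, haar_singleton]
  rw [← Finset.smul_sum, Pi.smul_apply, coeffFun, coeff_mul_eq_sum]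
  simp [coeffFun]

/-- On an infinite discrete group, `‖f‖_p^T` is not dominated by `‖f‖_p`. -/
theorem finite_of_normT_le [DiscreteTopology G] (hp1 : 1 < p) (hp2 : p ≤ 2) {C : ℝ≥0}
    (hC : ∀ f : G → ℂ, Continuous f → HasCompactSupport f →
      normT μ p f ≤ C * eLpNorm f p μ) : Finite G := by
  have hp : p ≠ ∞ := ne_top_of_le_ne_top ENNReal.ofNat_ne_top hp2
  have hp0 : p ≠ 0 := (zero_lt_one.trans hp1).ne'
  have hr1 : 1 < p.toReal := by
    rw [← ENNReal.toReal_one]; exact (ENNReal.toReal_lt_toReal ENNReal.one_ne_top hp).mpr hp1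
  have hr2 : p.toReal ≤ 2 := by
    simpa using ENNReal.toReal_mono ENNReal.ofNat_ne_top hp2
  by_contra hinf
  rw [not_finite_iff_infinite] at hinf
  have hc0 : μ {1} ≠ 0 := (isOpen_discrete _).measure_ne_zero μ (Set.singleton_nonempty _)
  have hctop : μ {1} ≠ ∞ := isCompact_singleton.measure_lt_top.ne
  obtain ⟨c, hc⟩ : ∃ c : ℝ≥0, (c : ℝ≥0∞) = μ {1} := ⟨_, ENNReal.coe_toNNReal hctop⟩
  have hcpos : 0 < c := by
    rw [pos_iff_ne_zero]; rintro rfl; exact hc0 hc.symm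
  have hcreal : μ.real {1} = c := by rw [Measure.real, ← hc, ENNReal.coe_toReal]
  obtain ⟨d, hd⟩ : ∃ d : ℝ≥0, d = c ^ (1 / p.toReal) := ⟨_, rfl⟩
  have hdpos : 0 < d := hd ▸ NNReal.rpow_pos hcpos
  have hnorm : ∀ f : MonoidAlgebra ℝ≥0 G,
      eLpNorm (coeffFun f) p μ = ((d * lpNorm p.toReal f : ℝ≥0) : ℝ≥0∞) := fun f => by
    rw [eLpNorm_coeffFun hp0 hp, ← hc, ← ENNReal.coe_rpow_of_nonneg _ (by positivity), ← hd,
      ENNReal.coe_mul]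
  -- With `c = μ {1}`, convolution is `c` times the algebra product and the `L^p` norm is `d = c ^
  -- (1 / p)` times the `ℓ^p` norm, whence the constant `C * d / c`.
  refine not_bounded_mul (G := G) (C := C * d / c) hr1 hr2 fun f g => ?_
  have hsupp : HasCompactSupport (coeffFun g) :=
    HasCompactSupport.intro g.coeff.support.finite_toSet.isCompact fun x hx =>
      coeffFun_eq_zero g hx
  have hmem : MemLp (coeffFun f) p μ :=
    ⟨continuous_of_discreteTopology.aestronglyMeasurable, hnorm f ▸ ENNReal.coe_lt_top⟩
  have h := (eLpNorm_conv_le_normT_mul hp0 hmem).trans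
    (mul_le_mul_left (hC (coeffFun g) continuous_of_discreteTopology hsupp) _)
  rw [conv_coeffFun, eLpNorm_const_smul, hnorm, hnorm, hnorm, hcreal, ← ofReal_norm,
    Complex.norm_real, NNReal.norm_eq, ENNReal.ofReal_coe_nnreal] at h
  have h' : c * (d * lpNorm p.toReal (f * g)) ≤
      C * (d * lpNorm p.toReal g) * (d * lpNorm p.toReal f) := by exact_mod_cast h
  have h2 : d * (c * lpNorm p.toReal (f * g)) ≤
      d * (C * d * lpNorm p.toReal f * lpNorm p.toReal g) := by
    calc _ = c * (d * lpNorm p.toReal (f * g)) := by ring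
      _ ≤ _ := h'
      _ = _ := by ring
  have h3 := le_of_mul_le_mul_left h2 hdpos
  rw [← le_div_iff₀' hcpos] at h3
  refine h3.trans_eq ?_
  field_simp

end Discrete

/-! ### The two inequalities on a finite group -/

section Finite

open Measure

variable {G : Type*} [Group G] [TopologicalSpace G] [IsTopologicalGroup G] [T2Space G]
  [MeasurableSpace G] [BorelSpace G] {μ : Measure G} [μ.IsHaarMeasure] {p : ℝ≥0∞}

/-- On a discrete group, `‖f‖_p` is dominated by `‖f‖_p^T`. -/
theorem exists_eLpNorm_le_normT {G : Type*} [Group G] [TopologicalSpace G] [DiscreteTopology G]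
    [MeasurableSpace G] [BorelSpace G] {μ : Measure G} [μ.IsHaarMeasure] (hp0 : p ≠ 0) :
    ∃ C : ℝ≥0, 0 < C ∧ ∀ f : G → ℂ, eLpNorm f p μ ≤ C * normT μ p f := by
  have hc0 : μ {1} ≠ 0 := (isOpen_discrete _).measure_ne_zero μ (Set.singleton_nonempty _)
  have hctop : μ {1} ≠ ∞ := isCompact_singleton.measure_lt_top.ne
  -- The indicator of the identity is a convolution unit up to the factor `μ {1}`.
  obtain ⟨g, hg⟩ : ∃ g : G → ℂ, g = Set.indicator {1} fun _ => 1 := ⟨_, rfl⟩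
  have hmem : MemLp g p μ :=
    hg ▸ memLp_indicator_const p (measurableSet_singleton 1) 1 (Or.inr hctop)
  have hconv : ∀ f : G → ℂ, conv μ g f = (μ.real {1} : ℂ) • f := fun f => by
    ext x
    have : ∀ y, g y * f (y⁻¹ * x) = Set.indicator {1} (fun _ => f x) y := fun y => by
      by_cases hy : y = 1
      · simp [hg, hy]
      · simp [hg, hy]
    rw [conv]
    simp_rw [this]
    rw [integral_indicator_const _ (measurableSet_singleton 1)]
    simp
  have hle : ∀ f : G → ℂ, eLpNorm f p μ ≤ (μ {1})⁻¹ * eLpNorm g p μ * normT μ p f := fun f => by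
    have h := eLpNorm_conv_le_normT_mul (f := f) hp0 hmem
    rw [hconv, eLpNorm_const_smul, ← ofReal_norm, Complex.norm_real, Real.norm_of_nonneg
      measureReal_nonneg, ofReal_measureReal hctop, mul_comm (normT μ p f),
      ENNReal.mul_le_iff_le_inv hc0 hctop] at h
    rwa [mul_assoc]
  have hK : (μ {1})⁻¹ * eLpNorm g p μ ≠ ∞ :=
    ENNReal.mul_ne_top (ENNReal.inv_ne_top.mpr hc0) hmem.eLpNorm_ne_top
  refine ⟨((μ {1})⁻¹ * eLpNorm g p μ).toNNReal + 1, by positivity, fun f => (hle f).trans ?_⟩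
  gcongr
  rw [ENNReal.coe_add, ENNReal.coe_toNNReal hK]
  exact le_self_add

/-- On a compact unimodular group, `‖f‖_p^T` is dominated by `‖f‖_p` for continuous `f`. -/
theorem exists_normT_le_eLpNorm [CompactSpace G] [μ.IsMulRightInvariant]
    (hp1 : 1 < p) (hp : p ≠ ∞) :
    ∃ C : ℝ≥0, 0 < C ∧ ∀ f : G → ℂ, Continuous f → normT μ p f ≤ C * eLpNorm f p μ := by
  have := isInvInvariant_of_isMulRightInvariant μ
  have hr1 : 1 < p.toReal := by
    rw [← ENNReal.toReal_one]; exact (ENNReal.toReal_lt_toReal ENNReal.one_ne_top hp).mpr hp1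
  have hK : μ Set.univ ^ (1 - 1 / p.toReal) ≠ ∞ := by
    refine ENNReal.rpow_ne_top_of_nonneg ?_ (measure_ne_top μ _)
    rw [sub_nonneg, div_le_one (by linarith)]
    exact hr1.le
  refine ⟨(μ Set.univ ^ (1 - 1 / p.toReal)).toNNReal + 1, by positivity, fun f hf => ?_⟩
  refine (normT_le_eLpNorm_one hp1 hp hf (HasCompactSupport.of_compactSpace f)).trans ?_
  refine (eLpNorm_le_eLpNorm_mul_rpow_measure_univ hp1.le hf.aestronglyMeasurable).trans ?_
  rw [mul_comm, ENNReal.toReal_one, div_one]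
  gcongr
  rw [ENNReal.coe_add, ENNReal.coe_toNNReal hK]
  exact le_self_add

end Finite

end LpT

theorem corollaryc {G : Type*} [Group G] [TopologicalSpace G] [IsTopologicalGroup G]
    [LocallyCompactSpace G] [T2Space G] [MeasurableSpace G] [BorelSpace G]
    (μ : Measure G) [μ.IsHaarMeasure] [μ.Regular]
    -- `G` is unimodular: its left Haar measure is also right invariant
    [μ.IsMulRightInvariant]
    (p : ℝ≥0∞) (hp1 : 1 < p) (hp2 : p ≤ 2) :
    LpT.EquivalentOn (LpT.space μ p) (fun f => eLpNorm f p μ) (LpT.normT μ p) ↔ Finite G := by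
  have hp : p ≠ ∞ := ne_top_of_le_ne_top ENNReal.ofNat_ne_top hp2
  have := LpT.isInvInvariant_of_isMulRightInvariant μ
  constructor
  · rintro ⟨⟨C₁, -, h₁⟩, ⟨C₂, -, h₂⟩⟩
    have : DiscreteTopology G := LpT.discreteTopology_of_eLpNorm_le (μ := μ) (C := C₁) hp1 hp
      fun f hf hf' => (h₁ f (LpT.mem_space_of_hasCompactSupport hp1 hp hf hf')).trans
        (mul_le_mul_right (LpT.normT_le_eLpNorm_one hp1 hp hf hf') _)
    exact LpT.finite_of_normT_le (μ := μ) hp1 hp2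
      fun f hf hf' => h₂ f (LpT.mem_space_of_hasCompactSupport hp1 hp hf hf')
  · intro hfin
    obtain ⟨C₁, hC₁, h₁⟩ := LpT.exists_eLpNorm_le_normT (μ := μ) (zero_lt_one.trans hp1).ne'
    obtain ⟨C₂, hC₂, h₂⟩ := LpT.exists_normT_le_eLpNorm (μ := μ) hp1 hp
    exact ⟨⟨C₁, hC₁, fun f _ => h₁ f⟩,
      ⟨C₂, hC₂, fun f _ => h₂ f continuous_of_discreteTopology⟩⟩
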